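/- For a finite graph $G$ and positive integers $r,t$, the diameter cover number $D_r^t(G)$ is the least integer $d\ge 0$ such that for every colouring of the edges of $G$ with $r$ colours there are $t$ connected monochromatic subgraphs of $G$, each of diameter at most $d$, such that every vertex of $G$ lies in at least one of them (if no such $d$ exists, $D_r^t(G)=\infty$). Here a subgraph is monochromatic if all of its edges have the same colour; in particular a single vertex is a monochromatic connected subgraph of diameter $0$, and the $t$ subgraphs may overlap and may have the same or different colours. Let $K_{a,b,c}$ denote the complete tripartite graph with parts of sizes $a,b,c$. Theorem. Let $G$ be a complete tripartite graph, i.e. $G\cong K_{a,b,c}$ for some integers $a,b,c\ge 1$. Then (i) $D_2^2(G)=3$ if and only if $G$ has a subgraph isomorphic to $K_{5,2,2}$ or a subgraph isomorphic to $K_{4,3,2}$; (ii) $D_2^2(G)=1$ if and only if $G\cong K_3$ or $G\cong K_{2,1,1}$; (iii) $D_2^2(G)=2$ in every other case, i.e. whenever $G$ has no subgraph isomorphic to $K_{5,2,2}$ or $K_{4,3,2}$ and $G$ is isomorphic to neither $K_3$ nor $K_{2,1,1}$. -/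

import Mathlib

/-- The complete tripartite graph `K_{a,b,c}` on parts of sizes `a`, `b`, `c`. -/
abbrev completeTripartiteGraph (a b c : ℕ) :
    SimpleGraph (Σ i : Fin 3, Fin (![a, b, c] i)) :=
  SimpleGraph.completeMultipartiteGraph fun i : Fin 3 => Fin (![a, b, c] i)

/-- `G` is a (finite) complete tripartite graph, that is, a copy of `K_{a,b,c}` for some
`a, b, c ≥ 1`. -/
def IsCompleteTripartite {V : Type*} (G : SimpleGraph V) : Prop :=
  ∃ a b c : ℕ, 1 ≤ a ∧ 1 ≤ b ∧ 1 ≤ c ∧ Nonempty (G ≃g completeTripartiteGraph a b c)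

/-- A subgraph `H` of `G` is monochromatic for the edge colouring `C` if all its edges have the
same colour. A subgraph without edges is monochromatic. -/
def IsMonochromatic {V K : Type*} {G : SimpleGraph V} (C : G.EdgeLabeling K)
    (H : G.Subgraph) : Prop :=
  ∃ k : K, ∀ e (he : e ∈ H.edgeSet), C ⟨e, H.edgeSet_subset he⟩ = k

/-- The edge colouring `C` of `G` admits a monochromatic connected subgraph cover with `t`
subgraphs, each of diameter at most `d`. -/
def HasMonochromaticCover {V K : Type*} {G : SimpleGraph V} (C : G.EdgeLabeling K)
    (t : ℕ) (d : ℕ∞) : Prop :=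
  ∃ H : Fin t → G.Subgraph,
    (∀ i, IsMonochromatic C (H i) ∧ (H i).Connected ∧ (H i).coe.ediam ≤ d) ∧
      ∀ v : V, ∃ i, v ∈ (H i).verts

/-- The diameter cover number `D_r^t(G)`: the least `d` such that every `r`-colouring of the
edges of `G` admits a monochromatic connected subgraph cover with `t` subgraphs of diameter at
most `d`. The value is `⊤` if there is no such finite `d`. -/
noncomputable def diameterCoverNumber {V : Type*} (r t : ℕ) (G : SimpleGraph V) : ℕ∞ :=
  sInf {d : ℕ∞ | ∀ C : G.EdgeLabeling (Fin r), HasMonochromaticCover C t d}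

/-! Call the colours red (`true`) and blue (`false`). A monochromatic subgraph may be replaced by
all edges of its colour on its vertex set, so a cover is a pair of vertex sets, each of small
diameter in one colour (`hasMonochromaticCover_iff_coverable`). Relations are reflexive, so covers
pass through surjections that may identify vertices (`Coverable.map`). This one principle yields
isomorphism invariance, monotonicity under complete tripartite subgraphs (by retraction,
`AlwaysCoverable.of_injective`), and the reduction of small parts to larger ones.

Diameter 3 always suffices (`alwaysCoverable_three`). If some vertex sends one colour to a whole
other part, a double star and a star do it. If red has diameter at most 3, the whole graph is one
set. Otherwise two vertices at red distance above 3 force so many blue edges that one large blue set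
is left with a remainder inside a red star or another blue set.

For diameter 2 a singleton part is easy: take the two stars at its vertex. By monotonicity the
remaining positive cases are contained in K_{3,3,3} or K_{4,2,2}. These are settled by a verified
search over partial colourings, accepting once some monochromatic star is found whose complement,
enlarged by at most one or two vertices, has diameter at most 2 in a colour. Explicit colourings of
K_{5,2,2} and K_{4,3,2} give the converse.

Diameter 1 means covering by two monochromatic cliques. Colouring the edges at one part differently
from the rest makes both colours bipartite, so at most four vertices are covered. Diameter 0 fails
since there are three vertices. -/

/-- `Reach r S n u v`: one can go from `u` to `v` in `n` steps of the relation `r`, all of them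
starting in `S`. -/
def Reach {V : Type*} (r : V → V → Prop) (S : Set V) : ℕ → V → V → Prop
  | 0, u, v => u = v
  | n + 1, u, v => ∃ w ∈ S, Reach r S n u w ∧ r w v

/-- For reflexive relations `K k`, one for each colour `k`: two nonempty sets cover `V`, each of
diameter at most `d` for one of the relations. -/
def Coverable {κ V : Type*} (K : κ → V → V → Prop) (d : ℕ) : Prop :=
  ∃ (S : Fin 2 → Set V) (k : Fin 2 → κ),
    (∀ i, (S i).Nonempty ∧ ∀ u ∈ S i, ∀ v ∈ S i, Reach (K (k i)) (S i) d u v) ∧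
      ∀ v, ∃ i, v ∈ S i

/-! ### Bounded-length paths and the functoriality of covers -/

section Reach

variable {V V' κ κ' : Type*} {r : V → V → Prop} {S : Set V}

theorem Reach.cons {u w v : V} (hu : u ∈ S) (huw : r u w) :
    ∀ {n : ℕ}, Reach r S n w v → Reach r S (n + 1) u v := by
  intro n
  induction n generalizing v with
  | zero => rintro rfl; exact ⟨u, hu, rfl, huw⟩
  | succ n ih => rintro ⟨x, hx, h, hxv⟩; exact ⟨x, hx, ih h, hxv⟩

theorem Reach.mono (hr : ∀ v, r v v) {n m : ℕ} (hnm : n ≤ m) {u v : V} (hv : v ∈ S)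
    (h : Reach r S n u v) : Reach r S m u v := by
  induction hnm with
  | refl => exact h
  | step _ ih => exact ⟨v, hv, ih, hr v⟩

theorem Reach.map {r' : V' → V' → Prop} (f : V → V') (hf : ∀ u v, r u v → r' (f u) (f v)) :
    ∀ {n : ℕ} {u v : V}, Reach r S n u v → Reach r' (f '' S) n (f u) (f v)
  | 0, _, _, h => congrArg f h
  | _ + 1, _, _, ⟨w, hw, h, hwv⟩ => ⟨f w, ⟨w, hw, rfl⟩, Reach.map f hf h, hf _ _ hwv⟩

/-- Images of the two sets work, since paths map to paths. When `K'` is reflexive, `f` may identify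
vertices freely. -/
theorem Coverable.map {K : κ → V → V → Prop} {K' : κ' → V' → V' → Prop} {d : ℕ} (f : V → V')
    (hf : f.Surjective) (g : κ → κ') (h : ∀ k u v, K k u v → K' (g k) (f u) (f v))
    (hK : Coverable K d) : Coverable K' d := by
  obtain ⟨S, k, hS, hc⟩ := hK
  refine ⟨fun i => f '' S i, fun i => g (k i), fun i => ⟨(hS i).1.image f, ?_⟩, fun v => ?_⟩
  · rintro _ ⟨u, hu, rfl⟩ _ ⟨v, hv, rfl⟩
    exact ((hS i).2 u hu v hv).map f (h _)
  · obtain ⟨v, rfl⟩ := hf v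
    obtain ⟨i, hi⟩ := hc v
    exact ⟨i, v, hi, rfl⟩

/-- Only one set needs to be nonempty: an empty `T` is replaced by a second copy of `S`. -/
theorem coverable_of_two {K : κ → V → V → Prop} {d : ℕ} {S T : Set V} {k l : κ}
    (hS : S.Nonempty) (hSd : ∀ u ∈ S, ∀ v ∈ S, Reach (K k) S d u v)
    (hTd : ∀ u ∈ T, ∀ v ∈ T, Reach (K l) T d u v) (hc : ∀ v, v ∈ S ∨ v ∈ T) :
    Coverable K d := by
  rcases T.eq_empty_or_nonempty with rfl | hT
  · exact ⟨fun _ => S, fun _ => k, fun _ => ⟨hS, hSd⟩, fun v => ⟨0, by simpa using hc v⟩⟩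
  · refine ⟨![S, T], ![k, l], fun i => ?_, fun v => ?_⟩
    · fin_cases i
      · exact ⟨hS, hSd⟩
      · exact ⟨hT, hTd⟩
    · rcases hc v with h | h
      · exact ⟨0, h⟩
      · exact ⟨1, h⟩

theorem Coverable.mono {K : κ → V → V → Prop} (hK : ∀ k v, K k v v) {d e : ℕ} (hde : d ≤ e)
    (h : Coverable K d) : Coverable K e := by
  obtain ⟨S, k, hS, hc⟩ := h
  exact ⟨S, k, fun i => ⟨(hS i).1, fun u hu v hv =>
    ((hS i).2 u hu v hv).mono (hK _) hde hv⟩, hc⟩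

end Reach

/-! ### From monochromatic subgraphs to sets of vertices -/

section Cover

open SimpleGraph

variable {V K : Type*} {G : SimpleGraph V}

/-- Being equal or joined by an edge of colour `k`. -/
def colorRel (C : G.EdgeLabeling K) (k : K) (u v : V) : Prop :=
  u = v ∨ ∃ h : G.Adj u v, C.get u v h = k

theorem colorRel_refl (C : G.EdgeLabeling K) (k : K) (v : V) : colorRel C k v v := Or.inl rfl

theorem reach_of_walk {C : G.EdgeLabeling K} {H : G.Subgraph} {k : K}
    (hk : ∀ e (he : e ∈ H.edgeSet), C ⟨e, H.edgeSet_subset he⟩ = k) {u v : H.verts}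
    (p : H.coe.Walk u v) : Reach (colorRel C k) H.verts p.length u v := by
  induction p with
  | nil => rfl
  | @cons u w v h p ih =>
    have h' : H.Adj u w := h
    exact ih.cons u.2 (Or.inr ⟨h'.adj_sub, hk _ (H.mem_edgeSet.2 h')⟩)

/-- The subgraph on `S` formed by the edges of colour `k`. -/
def colorSubgraph (C : G.EdgeLabeling K) (k : K) (S : Set V) : G.Subgraph where
  verts := S
  Adj u v := u ∈ S ∧ v ∈ S ∧ ∃ h : G.Adj u v, C.get u v h = k
  adj_sub h := h.2.2.1
  edge_vert h := h.1
  symm := ⟨fun u v ⟨hu, hv, h, hk⟩ => ⟨hv, hu, h.symm, by rw [C.get_comm]; exact hk⟩⟩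

theorem edist_colorSubgraph_le {C : G.EdgeLabeling K} {k : K} {S : Set V} {n : ℕ} {u v : V}
    (hu : u ∈ S) (hv : v ∈ S) (h : Reach (colorRel C k) S n u v) :
    (colorSubgraph C k S).coe.edist ⟨u, hu⟩ ⟨v, hv⟩ ≤ n := by
  induction n generalizing v with
  | zero => cases h; simp
  | succ n ih =>
    obtain ⟨w, hw, h, hwv⟩ := h
    refine (SimpleGraph.edist_triangle (v := (⟨w, hw⟩ : (colorSubgraph C k S).verts))).trans ?_
    rw [Nat.cast_add]
    refine add_le_add (ih hw h) ?_
    rw [Nat.cast_one, SimpleGraph.edist_le_one_iff_adj_or_eq]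
    rcases hwv with rfl | hwv
    · exact Or.inr rfl
    · exact Or.inl ⟨hw, hv, hwv⟩

/-- Walks shorter than `d` are padded by reflexive steps. Conversely, `colorSubgraph` has every edge
of its colour on `S`, so it realises all the required distances, and finite distances make it
connected. -/
theorem hasMonochromaticCover_iff_coverable (C : G.EdgeLabeling K) (d : ℕ) :
    HasMonochromaticCover C 2 d ↔ Coverable (colorRel C) d := by
  constructor
  · rintro ⟨H, hH, hc⟩
    choose hm hcon hd using hH
    choose k hk using hm
    refine ⟨fun i => (H i).verts, k, fun i => ⟨(hcon i).nonempty, fun u hu v hv => ?_⟩, hc⟩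
    have hle : (H i).coe.edist ⟨u, hu⟩ ⟨v, hv⟩ ≤ d := edist_le_ediam.trans (hd i)
    obtain ⟨p, hp⟩ := exists_walk_of_edist_ne_top (ne_top_of_le_ne_top (ENat.natCast_ne_top d) hle)
    rw [← hp] at hle
    exact (reach_of_walk (hk i) p).mono (colorRel_refl C _) (by exact_mod_cast hle) hv
  · rintro ⟨S, k, hS, hc⟩
    have hle : ∀ i (u v : (colorSubgraph C (k i) (S i)).verts),
        (colorSubgraph C (k i) (S i)).coe.edist u v ≤ d := fun i u v =>
      edist_colorSubgraph_le u.2 v.2 ((hS i).2 _ u.2 _ v.2)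
    refine ⟨fun i => colorSubgraph C (k i) (S i), fun i => ⟨⟨k i, ?_⟩, ?_, ?_⟩, hc⟩
    · intro e he
      induction e using Sym2.inductionOn with
      | _ u v => exact (Subgraph.mem_edgeSet.1 he).2.2.2
    · have : Nonempty (colorSubgraph C (k i) (S i)).verts := (hS i).1.to_subtype
      exact ⟨⟨fun u v => reachable_of_edist_ne_top
        (ne_top_of_le_ne_top (ENat.natCast_ne_top d) (hle i u v))⟩⟩
    · exact ediam_le_of_edist_le (hle i)

end Cover

/-! ### Two-colourings of complete multipartite graphs -/

section Always

/-- In the complete multipartite graph with part map `p`, edge-coloured by `c`: being equal or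
joined by an edge of colour `k`. -/
def partRel {V ι : Type*} (p : V → ι) (c : V → V → Bool) (k : Bool) (u v : V) : Prop :=
  u = v ∨ p u ≠ p v ∧ c u v = k

/-- Every edge colouring of the complete multipartite graph with part map `p` has a cover by two
sets of diameter at most `d`. -/
def AlwaysCoverable {V ι : Type*} (p : V → ι) (d : ℕ) : Prop :=
  ∀ c : V → V → Bool, (∀ u v, c u v = c v u) → Coverable (partRel p c) d

variable {V V' ι ι' : Type*} {p : V → ι} {p' : V' → ι'}

theorem partRel_refl (p : V → ι) (c : V → V → Bool) (k : Bool) (v : V) : partRel p c k v v :=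
  Or.inl rfl

/-- Pull the colouring back along `f`, cover there, and push the cover forward. -/
theorem AlwaysCoverable.map {d : ℕ} (h : AlwaysCoverable p d) (f : V → V') (hf : f.Surjective)
    (hp : ∀ u v, p u ≠ p v → p' (f u) ≠ p' (f v)) : AlwaysCoverable p' d := fun c hc =>
  (h (fun u v => c (f u) (f v)) fun _ _ => hc _ _).map f hf id fun k u v => by
    rintro (rfl | ⟨hne, rfl⟩)
    · exact Or.inl rfl
    · exact Or.inr ⟨hp _ _ hne, rfl⟩

theorem AlwaysCoverable.mono {d e : ℕ} (hde : d ≤ e) (h : AlwaysCoverable p d) :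
    AlwaysCoverable p e := fun c hc => (h c hc).mono (partRel_refl p c) hde

theorem forall_hasMonochromaticCover_iff {G : SimpleGraph V} (hp : ∀ u v, G.Adj u v ↔ p u ≠ p v)
    (d : ℕ) :
    (∀ C : G.EdgeLabeling (Fin 2), HasMonochromaticCover C 2 d) ↔ AlwaysCoverable p d := by
  simp only [hasMonochromaticCover_iff_coverable]
  constructor
  · intro h c hc
    refine (h (SimpleGraph.EdgeLabeling.mk (fun u v _ => bif c u v then 1 else 0)
      (fun u v _ => by rw [hc]))).map id Function.surjective_id (fun k => decide (k = 1)) ?_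
    rintro k u v (rfl | ⟨h, hk⟩)
    · exact Or.inl rfl
    · rw [SimpleGraph.EdgeLabeling.get_mk] at hk
      refine Or.inr ⟨(hp _ _).1 h, ?_⟩
      subst hk
      cases h : c u v <;> simp [h]
  · intro h C
    classical
    refine (h (fun u v => if huv : G.Adj u v then decide (C.get u v huv = 1) else false) ?_).map
      id Function.surjective_id (fun b => bif b then 1 else 0) ?_
    · intro u v
      by_cases huv : G.Adj u v
      · rw [dif_pos huv, dif_pos huv.symm, C.get_comm]
      · rw [dif_neg huv, dif_neg fun h => huv h.symm]
    · rintro k u v (rfl | ⟨hne, hk⟩)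
      · exact Or.inl rfl
      · have huv := (hp u v).2 hne
        refine Or.inr ⟨huv, ?_⟩
        simp only [dif_pos huv] at hk
        subst hk
        show C.get u v huv = _
        generalize C.get u v huv = x
        fin_cases x <;> rfl

theorem diameterCoverNumber_le_iff {G : SimpleGraph V} (hp : ∀ u v, G.Adj u v ↔ p u ≠ p v)
    (d : ℕ) : diameterCoverNumber 2 2 G ≤ d ↔ AlwaysCoverable p d := by
  rw [← forall_hasMonochromaticCover_iff hp]
  constructor
  · intro h C
    -- The infimum is attained: over the empty set it would be `⊤`, and a nonempty subset of `ℕ∞`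
    -- has a least element.
    have hne : {d : ℕ∞ | ∀ C : G.EdgeLabeling (Fin 2), HasMonochromaticCover C 2 d}.Nonempty := by
      by_contra hne
      rw [Set.not_nonempty_iff_eq_empty] at hne
      rw [diameterCoverNumber, hne, sInf_empty, top_le_iff] at h
      exact ENat.natCast_ne_top d h
    obtain ⟨H, hH, hc⟩ := csInf_mem hne C
    exact ⟨H, fun i => ⟨(hH i).1, (hH i).2.1, (hH i).2.2.trans h⟩, hc⟩
  · exact fun h => sInf_le h

end Always

/-! ### Stars have diameter at most 2, double stars at most 3 -/

section Stars

variable {V : Type*} {r : V → V → Prop} {S : Set V}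

theorem reach_two {u w v : V} (hu : u ∈ S) (hw : w ∈ S) (h₁ : r u w) (h₂ : r w v) :
    Reach r S 2 u v := ⟨w, hw, ⟨u, hu, rfl, h₁⟩, h₂⟩

theorem reach_three {u s t v : V} (hu : u ∈ S) (hs : s ∈ S) (ht : t ∈ S) (h₁ : r u s) (h₂ : r s t)
    (h₃ : r t v) : Reach r S 3 u v := ⟨t, ht, reach_two hu hs h₁ h₂, h₃⟩

theorem reach_star (hr : ∀ v, r v v) (hs : ∀ u v, r u v → r v u) (z : V) :
    ∀ u ∈ {x | r z x}, ∀ v ∈ {x | r z x}, Reach r {x | r z x} 2 u v := fun _ hu _ hv =>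
  reach_two hu (hr z) (hs _ _ hu) hv

theorem reach_doubleStar (hr : ∀ v, r v v) (hs : ∀ u v, r u v → r v u) {y z : V} (h : r y z) :
    ∀ u ∈ {x | r y x ∨ r z x}, ∀ v ∈ {x | r y x ∨ r z x},
      Reach r {x | r y x ∨ r z x} 3 u v := by
  have hy : y ∈ {x | r y x ∨ r z x} := Or.inl (hr y)
  have hz : z ∈ {x | r y x ∨ r z x} := Or.inr (hr z)
  rintro u hu v hv
  rcases id hu with hu' | hu' <;> rcases id hv with hv' | hv'
  · exact reach_three hu hy hy (hs _ _ hu') (hr y) hv'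
  · exact reach_three hu hy hz (hs _ _ hu') h hv'
  · exact reach_three hu hz hy (hs _ _ hu') (hs _ _ h) hv'
  · exact reach_three hu hz hz (hs _ _ hu') (hr z) hv'

end Stars

/-! ### Diameter 3 always suffices -/

section Three

variable {V : Type*} {p : V → Fin 3} {c : V → V → Bool}

theorem partRel_symm {ι : Type*} {p : V → ι} (hc : ∀ u v, c u v = c v u) (k : Bool) (u v : V) :
    partRel p c k u v → partRel p c k v u := by
  rintro (rfl | ⟨h, hk⟩)
  · exact Or.inl rfl
  · exact Or.inr ⟨h.symm, by rw [hc]; exact hk⟩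

/-- If some vertex has only edges of one colour to some part, there is a cover of diameter `3`. -/
theorem coverable_three_of_constant (hc : ∀ u v, c u v = c v u) {v u : V} {k : Bool}
    (hvu : p v ≠ p u) (h : ∀ x, p x = p u → c v x = k) : Coverable (partRel p c) 3 := by
  have hr := partRel_refl p c
  have hs := fun k => partRel_symm (p := p) hc k
  -- The double star of the edge `vu` contains the part of `u` (through `v`) and all `k`-neighbours
  -- of `u`; the star of `u` in the other colour takes the rest.
  refine coverable_of_two (k := k) (l := !k) ⟨v, Or.inl (hr k v)⟩
    (reach_doubleStar (hr k) (hs k) (Or.inr ⟨hvu, h u rfl⟩))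
    (fun x hx y hy => (reach_star (hr !k) (hs !k) u x hx y hy).mono (hr _) (by norm_num) hy)
    fun x => ?_
  by_cases hx : p u = p x
  · exact Or.inl (Or.inl (Or.inr ⟨hx ▸ hvu, h x hx.symm⟩))
  · by_cases hux : c u x = k
    · exact Or.inl (Or.inr (Or.inr ⟨hx, hux⟩))
    · exact Or.inr (Or.inr ⟨hx, by cases k <;> simpa using hux⟩)

/-- The case of two vertices in different parts that are far apart in one colour. -/
theorem coverable_three_of_far_of_ne (hc : ∀ u v, c u v = c v u) {x y : V} (hxy : p x ≠ p y)
    (h : ¬ Reach (partRel p c true) Set.univ 3 x y) : Coverable (partRel p c) 3 := by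
  have hr := partRel_refl p c
  have hs := fun k => partRel_symm (p := p) hc k
  have far : ∀ s t, partRel p c true x s → partRel p c true s t → ¬ partRel p c true t y :=
    fun s t h₁ h₂ h₃ => h (reach_three trivial trivial trivial h₁ h₂ h₃)
  have blue : ∀ u v, p u ≠ p v → ¬ partRel p c true u v → partRel p c false u v := fun u v hne hn =>
    Or.inr ⟨hne, by by_contra hh; exact hn (Or.inr ⟨hne, by simpa using hh⟩)⟩
  have hxyb : partRel p c false x y := blue x y hxy fun hh => far x y (hr _ _) hh (hr _ _)
  -- `T` contains all that the blue double star of `xy` misses: a vertex of the third part cannot be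
  -- red to both `x` and `y`.
  set T : Set V := {z | partRel p c true y z ∧ p z = p x ∨ partRel p c true x z ∧ p z = p y} with hT
  have cov : ∀ z, z ∈ {z | partRel p c false x z ∨ partRel p c false y z} ∨ z ∈ T := by
    intro z
    by_contra hz
    simp only [hT, Set.mem_ofPred_eq, not_or, not_and] at hz
    obtain ⟨⟨h₁, h₂⟩, h₃, h₄⟩ := hz
    by_cases hx : p x = p z
    · exact h₂ (blue _ _ (fun hh => hxy (hx.trans hh.symm)) fun hh => h₃ hh hx.symm)
    · by_cases hy : p y = p z
      · exact h₁ (blue _ _ hx fun hh => h₄ hh hy.symm)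
      · have h₅ : partRel p c true x z := by
          by_contra hh; exact h₁ (blue _ _ hx hh)
        have h₆ : partRel p c true y z := by
          by_contra hh; exact h₂ (blue _ _ hy hh)
        exact far z z h₅ (hr _ _) (hs _ _ _ h₆)
  have dbl := reach_doubleStar (hr false) (hs false) hxyb
  have hne : Set.Nonempty {z | partRel p c false x z ∨ partRel p c false y z} :=
    ⟨x, Or.inl (hr _ _)⟩
  by_cases hX : ∃ b, partRel p c true x b ∧ p b = p y
  · by_cases hY : ∃ a, partRel p c true y a ∧ p a = p x
    · obtain ⟨b, hb, hbp⟩ := hX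
      obtain ⟨a, ha, hap⟩ := hY
      -- A red edge `ab` would give the red path `x, b, a, y`. So when both halves of `T` are
      -- nonempty, `T` spans a complete bipartite blue graph.
      have cross : ∀ a b, partRel p c true y a → p a = p x → partRel p c true x b → p b = p y →
          partRel p c false a b := fun a b ha hap hb hbp =>
        blue _ _ (by rw [hap, hbp]; exact hxy) fun hh => far b a hb (hs _ _ _ hh) (hs _ _ _ ha)
      have haT : a ∈ T := Or.inl ⟨ha, hap⟩
      have hbT : b ∈ T := Or.inr ⟨hb, hbp⟩
      refine coverable_of_two hne dbl (l := false) (T := T) (fun u hu v hv => ?_) cov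
      rcases hu with ⟨hu', hup⟩ | ⟨hu', hup⟩ <;> rcases hv with ⟨hv', hvp⟩ | ⟨hv', hvp⟩
      · exact reach_three (Or.inl ⟨hu', hup⟩) hbT hbT (cross _ _ hu' hup hb hbp) (hr _ _)
          (hs _ _ _ (cross _ _ hv' hvp hb hbp))
      · exact reach_three (Or.inl ⟨hu', hup⟩) hbT haT (cross _ _ hu' hup hb hbp)
          (hs _ _ _ (cross _ _ ha hap hb hbp)) (cross _ _ ha hap hv' hvp)
      · exact reach_three (Or.inr ⟨hu', hup⟩) haT hbT (hs _ _ _ (cross _ _ ha hap hu' hup))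
          (cross _ _ ha hap hb hbp) (hs _ _ _ (cross _ _ hv' hvp hb hbp))
      · exact reach_three (Or.inr ⟨hu', hup⟩) haT haT (hs _ _ _ (cross _ _ ha hap hu' hup))
          (hr _ _) (cross _ _ ha hap hv' hvp)
    -- With one half of `T` empty, the other lies in a red star.
    · refine coverable_of_two hne dbl (l := true) (T := {z | partRel p c true x z})
        (fun u hu v hv => (reach_star (hr _) (hs _) x u hu v hv).mono (hr _) (by norm_num) hv)
        fun z => (cov z).imp_right ?_
      rintro (hz | hz)
      · exact (hY ⟨z, hz⟩).elim
      · exact hz.1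
  · refine coverable_of_two hne dbl (l := true) (T := {z | partRel p c true y z})
      (fun u hu v hv => (reach_star (hr _) (hs _) y u hu v hv).mono (hr _) (by norm_num) hv)
      fun z => (cov z).imp_right ?_
    rintro (hz | hz)
    · exact hz.1
    · exact (hX ⟨z, hz⟩).elim

/-- The case of two vertices of one part that are far apart in one colour. -/
theorem coverable_three_of_far_of_eq (hc : ∀ u v, c u v = c v u)
    (hconst : ∀ v j k, p v ≠ j → ∃ u, p u = j ∧ c v u = k) {x y : V} (hxy : p x = p y)
    (h : ¬ Reach (partRel p c true) Set.univ 3 x y) : Coverable (partRel p c) 3 := by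
  have hr := partRel_refl p c
  have hs := fun k => partRel_symm (p := p) hc k
  have far : ∀ s t, partRel p c true x s → partRel p c true s t → ¬ partRel p c true t y :=
    fun s t h₁ h₂ h₃ => h (reach_three trivial trivial trivial h₁ h₂ h₃)
  have third : ∀ i : Fin 3, ∃ j l : Fin 3, j ≠ i ∧ l ≠ i ∧ j ≠ l := by decide
  have other : ∀ i j : Fin 3, ∃ l : Fin 3, l ≠ i ∧ l ≠ j := by decide
  obtain ⟨j, l, hj, hl, hjl⟩ := third (p x)
  -- Any vertex of part `j` serves; its colour to `x` plays no role.
  obtain ⟨b, hb, -⟩ := hconst x j true hj.symm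
  -- The omitted vertices lie in the part of `x` and are red to `b`, hence in the red star of `b`.
  -- It remains to bound the blue diameter of `S` by 3.
  set S : Set V := {u | p u ≠ p x ∨ u = x ∨ u = y ∨ p u = p x ∧ c u b = false} with hSdef
  have hSo : ∀ u, p u ≠ p x → u ∈ S := fun u hu => Or.inl hu
  have hSx : x ∈ S := Or.inr (Or.inl rfl)
  have hSy : y ∈ S := Or.inr (Or.inr (Or.inl rfl))
  have bx : ∀ u, p u ≠ p x → c y u = true → partRel p c false x u := fun u hu hy =>
    Or.inr ⟨hu.symm, by
      by_contra hh
      exact far u u (Or.inr ⟨hu.symm, by simpa using hh⟩) (hr _ _)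
        (hs _ _ _ (Or.inr ⟨hxy ▸ hu.symm, hy⟩))⟩
  have by' : ∀ u, p u ≠ p x → c x u = true → partRel p c false y u := fun u hu hx =>
    Or.inr ⟨hxy ▸ hu.symm, by
      by_contra hh
      exact far u u (Or.inr ⟨hu.symm, hx⟩) (hr _ _)
        (hs _ _ _ (Or.inr ⟨hxy ▸ hu.symm, by simpa using hh⟩))⟩
  have bxy : ∀ u w, p u ≠ p x → p w ≠ p x → p u ≠ p w → c x u = true → c y w = true →
      partRel p c false u w := fun u w hu hw huw hxu hyw =>
    Or.inr ⟨huw, by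
      by_contra hh
      exact far u w (Or.inr ⟨hu.symm, hxu⟩) (Or.inr ⟨huw, by simpa using hh⟩)
        (hs _ _ _ (Or.inr ⟨hxy ▸ hw.symm, hyw⟩))⟩
  -- outside the part of `x` and `y`, everything is within distance two of `x` and of `y`
  have dx : ∀ u, p u ≠ p x → ∃ w ∈ S, partRel p c false u w ∧ partRel p c false w x := by
    intro u hu
    cases hxu : c x u with
    | false => exact ⟨u, hSo u hu, hr _ _, hs _ _ _ (Or.inr ⟨hu.symm, hxu⟩)⟩
    | true =>
      -- Take `w` in the third part, red to `y`. Since `u` is red to `x`, a red `uw` or a red `wx`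
      -- would join `x` to `y` by a short red path, so `u, w, x` is a blue path.
      obtain ⟨m, hm, hmu⟩ := other (p x) (p u)
      obtain ⟨w, hw, hyw⟩ := hconst y m true (hxy ▸ hm.symm)
      subst hw
      exact ⟨w, hSo w hm, bxy u w hu hm hmu.symm hxu hyw, hs _ _ _ (bx w hm hyw)⟩
  have dy : ∀ u, p u ≠ p x → ∃ w ∈ S, partRel p c false u w ∧ partRel p c false w y := by
    intro u hu
    cases hyu : c y u with
    | false => exact ⟨u, hSo u hu, hr _ _, hs _ _ _ (Or.inr ⟨hxy ▸ hu.symm, hyu⟩)⟩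
    | true =>
      obtain ⟨m, hm, hmu⟩ := other (p x) (p u)
      obtain ⟨w, hw, hxw⟩ := hconst x m true hm.symm
      subst hw
      exact ⟨w, hSo w hm, hs _ _ _ (bxy w u hm hu hmu hxw hyu), hs _ _ _ (by' w hm hxw)⟩
  have dne : ∀ u w, p u ≠ p x → p w ≠ p x → p u ≠ p w →
      ∃ s ∈ S, partRel p c false u s ∧ partRel p c false s w := by
    intro u w hu hw huw
    cases hxu : c x u with
    | true =>
      cases hyw : c y w with
      | true => exact ⟨u, hSo u hu, hr _ _, bxy u w hu hw huw hxu hyw⟩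
      | false =>
        exact ⟨y, hSy, hs _ _ _ (by' u hu hxu), Or.inr ⟨hxy ▸ hw.symm, hyw⟩⟩
    | false =>
      have hux : partRel p c false u x := hs _ _ _ (Or.inr ⟨hu.symm, hxu⟩)
      cases hxw : c x w with
      | false => exact ⟨x, hSx, hux, Or.inr ⟨hw.symm, hxw⟩⟩
      | true =>
        cases hyu : c y u with
        | true => exact ⟨u, hSo u hu, hr _ _, hs _ _ _ (bxy w u hw hu huw.symm hxw hyu)⟩
        | false =>
          exact ⟨y, hSy, hs _ _ _ (Or.inr ⟨hxy ▸ hu.symm, hyu⟩), by' w hw hxw⟩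
  have deq : ∀ u w, p u ≠ p x → p u = p w → Reach (partRel p c false) S 3 u w := by
    intro u w hu huw
    have hw : p w ≠ p x := huw ▸ hu
    cases hxu : c x u with
    | true =>
      cases hyw : c y w with
      | true =>
        obtain ⟨s, hs', hs₁, hs₂⟩ := dx u hu
        exact reach_three (hSo u hu) hs' hSx hs₁ hs₂ (bx w hw hyw)
      | false =>
        exact reach_three (hSo u hu) hSy hSy (hs _ _ _ (by' u hu hxu)) (hr _ _)
          (Or.inr ⟨hxy ▸ hw.symm, hyw⟩)
    | false =>
      have hux : partRel p c false u x := hs _ _ _ (Or.inr ⟨hu.symm, hxu⟩)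
      obtain ⟨s, hs', hs₁, hs₂⟩ := dx w hw
      exact reach_three (hSo u hu) hSx hs' hux (hs _ _ _ hs₂) (hs _ _ _ hs₁)
  have dxy : Reach (partRel p c false) S 3 x y := by
    obtain ⟨u, hu, hyu⟩ := hconst y j true (hxy ▸ hj.symm)
    subst hu
    obtain ⟨s, hs', hs₁, hs₂⟩ := dy u hj
    exact reach_three hSx (hSo u hj) hs' (bx u hj hyu) hs₁ hs₂
  have symm : ∀ u v, v ∈ S → Reach (partRel p c false) S 3 u v →
      Reach (partRel p c false) S 3 v u := by
    rintro u v hv ⟨t, ht, ⟨s, hs', ⟨u', hu', rfl, h₁⟩, h₂⟩, h₃⟩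
    exact reach_three hv ht hs' (hs _ _ _ h₃) (hs _ _ _ h₂) (hs _ _ _ h₁)
  have da : ∀ a, p a = p x → c a b = false → ∀ v ∈ S,
      Reach (partRel p c false) S 3 a v := by
    intro a ha hab v hv
    have haS : a ∈ S := Or.inr (Or.inr (Or.inr ⟨ha, hab⟩))
    have hbx : p b ≠ p x := hb ▸ hj
    have hab' : partRel p c false a b := Or.inr ⟨ha ▸ hbx.symm, hab⟩
    rcases hv with hv | rfl | rfl | ⟨hv, hvb⟩
    -- `dne` needs different parts. If `v` lies in the part of `b`, start instead from a blue
    -- neighbour of `a` in the third part `l`.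
    · by_cases hvb : p v = p b
      · obtain ⟨w, hw, haw⟩ := hconst a l false (ha ▸ hl.symm)
        subst hw
        obtain ⟨s, hs', hs₁, hs₂⟩ := dne w v hl hv (by rw [hvb, hb]; exact hjl.symm)
        exact reach_three haS (hSo w hl) hs' (Or.inr ⟨ha ▸ hl.symm, haw⟩) hs₁ hs₂
      · obtain ⟨s, hs', hs₁, hs₂⟩ := dne b v hbx hv (Ne.symm hvb)
        exact reach_three haS (hSo b hbx) hs' hab' hs₁ hs₂
    · obtain ⟨s, hs', hs₁, hs₂⟩ := dx b hbx
      exact reach_three haS (hSo b hbx) hs' hab' hs₁ hs₂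
    · obtain ⟨s, hs', hs₁, hs₂⟩ := dy b hbx
      exact reach_three haS (hSo b hbx) hs' hab' hs₁ hs₂
    · exact reach_three haS (hSo b hbx) (hSo b hbx) hab' (hr _ _)
        (hs _ _ _ (Or.inr ⟨hv ▸ hbx.symm, hvb⟩))
  have dox : ∀ u, p u ≠ p x → Reach (partRel p c false) S 3 u x := fun u hu => by
    obtain ⟨s, hs', hs₁, hs₂⟩ := dx u hu
    exact reach_three (hSo u hu) hs' hSx hs₁ hs₂ (hr _ _)
  have doy : ∀ u, p u ≠ p x → Reach (partRel p c false) S 3 u y := fun u hu => by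
    obtain ⟨s, hs', hs₁, hs₂⟩ := dy u hu
    exact reach_three (hSo u hu) hs' hSy hs₁ hs₂ (hr _ _)
  refine coverable_of_two (S := S) (k := false) (l := true) (T := {z | partRel p c true b z})
    ⟨x, hSx⟩ ?_
    (fun u hu v hv => (reach_star (hr _) (hs _) b u hu v hv).mono (hr _) (by norm_num) hv) ?_
  · intro u hu v hv
    rcases id hu with hu' | rfl | rfl | ⟨hu', hub⟩
    · rcases id hv with hv' | rfl | rfl | ⟨hv', hvb⟩
      · by_cases huv : p u = p v
        · exact deq u v hu' huv
        · obtain ⟨s, hs', hs₁, hs₂⟩ := dne u v hu' hv' huv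
          exact reach_three hu hs' hv hs₁ hs₂ (hr _ _)
      · exact dox u hu'
      · exact doy u hu'
      · exact symm _ _ hu (da v hv' hvb u hu)
    · rcases id hv with hv' | rfl | rfl | ⟨hv', hvb⟩
      · exact symm _ _ hu (dox v hv')
      · exact reach_three hSx hSx hSx (hr _ _) (hr _ _) (hr _ _)
      · exact dxy
      · exact symm _ _ hu (da v hv' hvb _ hu)
    · rcases id hv with hv' | rfl | rfl | ⟨hv', hvb⟩
      · exact symm _ _ hu (doy v hv')
      · exact symm _ _ hu dxy
      · exact reach_three hSy hSy hSy (hr _ _) (hr _ _) (hr _ _)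
      · exact symm _ _ hu (da v hv' hvb _ hu)
    · exact da u hu' hub v hv
  · intro z
    by_cases hz : p z = p x
    · cases hzb : c z b with
      | false => exact Or.inl (Or.inr (Or.inr (Or.inr ⟨hz, hzb⟩)))
      | true => exact Or.inr (hs _ _ _ (Or.inr ⟨by rw [hz, hb]; exact hj.symm, hzb⟩))
    · exact Or.inl (Or.inl hz)

theorem alwaysCoverable_three (hp : p.Surjective) : AlwaysCoverable p 3 := by
  intro c hc
  by_cases hconst : ∀ v j k, p v ≠ j → ∃ u, p u = j ∧ c v u = k
  · by_cases hfar : ∀ x y, Reach (partRel p c true) Set.univ 3 x y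
    · obtain ⟨v, -⟩ := hp 0
      exact coverable_of_two (S := Set.univ) (T := Set.univ) ⟨v, trivial⟩ (fun x _ y _ => hfar x y)
        (fun x _ y _ => hfar x y) fun _ => Or.inl trivial
    · push Not at hfar
      obtain ⟨x, y, hxy⟩ := hfar
      by_cases h : p x = p y
      · exact coverable_three_of_far_of_eq hc hconst h hxy
      · exact coverable_three_of_far_of_ne hc h hxy
  · push Not at hconst
    obtain ⟨v, j, k, hvj, h⟩ := hconst
    obtain ⟨u, rfl⟩ := hp j
    exact coverable_three_of_constant hc (k := !k) hvj fun x hx => by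
      have := h x hx
      cases k <;> simpa using this

end Three

/-! ### Singleton parts and diameters 0 and 1 -/

section Small

variable {V ι : Type*} {p : V → ι}

/-- If a part is a singleton, the two monochromatic stars at its vertex form a cover. -/
theorem alwaysCoverable_two_of_singleton {z : V} (hz : ∀ v, p v = p z → v = z) :
    AlwaysCoverable p 2 := by
  intro c hc
  have hr := partRel_refl p c
  have hs := fun k => partRel_symm (p := p) hc k
  refine coverable_of_two (k := true) (l := false) (S := {x | partRel p c true z x})
    (T := {x | partRel p c false z x}) ⟨z, hr _ _⟩ (reach_star (hr _) (hs _) z)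
    (reach_star (hr _) (hs _) z) fun v => ?_
  by_cases hv : p v = p z
  · exact Or.inl (Or.inl (hz v hv).symm)
  · cases h : c z v with
    | true => exact Or.inl (Or.inr ⟨Ne.symm hv, h⟩)
    | false => exact Or.inr (Or.inr ⟨Ne.symm hv, h⟩)

/-- Two disjoint edges cover four vertices. -/
theorem alwaysCoverable_one_of_pairs {x y x' y' : V} (hxy : p x ≠ p y) (hxy' : p x' ≠ p y')
    (h : ∀ v, v = x ∨ v = y ∨ v = x' ∨ v = y') : AlwaysCoverable p 1 := by
  intro c hc
  have key : ∀ x y, p x ≠ p y → ∀ u ∈ ({x, y} : Set V), ∀ v ∈ ({x, y} : Set V),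
      Reach (partRel p c (c x y)) {x, y} 1 u v := by
    rintro x y hxy u hu v hv
    refine ⟨u, hu, rfl, ?_⟩
    rcases hu with rfl | rfl <;> rcases hv with rfl | rfl
    · exact Or.inl rfl
    · exact Or.inr ⟨hxy, rfl⟩
    · exact Or.inr ⟨hxy.symm, hc _ _⟩
    · exact Or.inl rfl
  refine coverable_of_two ⟨x, Or.inl rfl⟩ (key x y hxy) (key x' y' hxy') fun v => ?_
  rcases h v with rfl | rfl | rfl | rfl <;> simp

theorem not_alwaysCoverable_zero {x y z : V} (hxy : x ≠ y) (hxz : x ≠ z) (hyz : y ≠ z) :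
    ¬ AlwaysCoverable p 0 := by
  intro h
  obtain ⟨S, k, hS, hc⟩ := h (fun _ _ => true) fun _ _ => rfl
  have key : ∀ i, ∀ u ∈ S i, ∀ v ∈ S i, u = v := fun i => (hS i).2
  obtain ⟨i, hi⟩ := hc x
  obtain ⟨j, hj⟩ := hc y
  obtain ⟨l, hl⟩ := hc z
  have h₁ : i ≠ j := by rintro rfl; exact hxy (key _ _ hi _ hj)
  have h₂ : i ≠ l := by rintro rfl; exact hxz (key _ _ hi _ hl)
  have h₃ : j ≠ l := by rintro rfl; exact hyz (key _ _ hj _ hl)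
  omega

/-- Colouring the edges between two parts differently from all others leaves no monochromatic
triangle. -/
theorem card_le_four_of_alwaysCoverable_one [Fintype V] {p : V → Fin 3}
    (h : AlwaysCoverable p 1) : Fintype.card V ≤ 4 := by
  classical
  obtain ⟨S, k, hS, hc⟩ := h (fun u v => decide (p u ≠ 2 ∧ p v ≠ 2))
    fun u v => by simp only [and_comm]
  have key : ∀ i, (S i).toFinset.card ≤ 2 := by
    intro i
    by_contra hcard
    obtain ⟨x, y, z, hx, hy, hz, hxy, hxz, hyz⟩ := Finset.two_lt_card_iff.1 (not_le.1 hcard)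
    have rel : ∀ u ∈ S i, ∀ v ∈ S i, u ≠ v → p u ≠ p v ∧ decide (p u ≠ 2 ∧ p v ≠ 2) = k i := by
      intro u hu v hv huv
      obtain ⟨w, -, rfl, hw⟩ := (hS i).2 u hu v hv
      exact hw.resolve_left huv
    rw [Set.mem_toFinset] at hx hy hz
    have h₁ := rel x hx y hy hxy
    have h₂ := rel x hx z hz hxz
    have h₃ := rel y hy z hz hyz
    clear rel
    generalize p x = a at *
    generalize p y = b at *
    generalize p z = d at *
    generalize k i = e at *
    revert a b d e
    decide
  have hu : (Finset.univ : Finset V) ⊆ (S 0).toFinset ∪ (S 1).toFinset := by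
    intro v _
    obtain ⟨i, hi⟩ := hc v
    fin_cases i
    · exact Finset.mem_union_left _ (Set.mem_toFinset.2 hi)
    · exact Finset.mem_union_right _ (Set.mem_toFinset.2 hi)
  calc Fintype.card V ≤ ((S 0).toFinset ∪ (S 1).toFinset).card := Finset.card_le_card hu
    _ ≤ _ := Finset.card_union_le _ _
    _ ≤ 4 := by have := key 0; have := key 1; omega

end Small

/-! ### A verified search over edge colourings

A graph on the vertices `0, …, 8` is stored as a natural number whose bit `9 * i + j` tells
whether `i = j` or `i` and `j` are adjacent; a set of vertices is stored as a number with nine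
bits. All functions are written so that the kernel evaluates them quickly. -/

namespace BitSearch

noncomputable section

/-- Evaluate `n` before passing it to `f`. -/
def force {α : Type} (n : ℕ) (f : ℕ → α) : α := Nat.rec (f 0) (fun m _ => f (Nat.succ m)) n

def anyL {α : Type} (p : α → Bool) (l : List α) : Bool :=
  List.rec false (fun h _ ih => Bool.rec ih true (p h)) l

def allL {α : Type} (p : α → Bool) (l : List α) : Bool :=
  List.rec true (fun h _ ih => Bool.rec false ih (p h)) l

/-- All bits of `x` are bits of `y`. -/
def sub (x y : ℕ) : Bool := Nat.beq (Nat.land x y) x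

/-- The number with bits `0, 9, …, 72`. -/
abbrev diag : ℕ := 0x1008040201008040201

def row (M v : ℕ) : ℕ := Nat.land (Nat.shiftRight M (Nat.mul 9 v)) 511

def col (M v : ℕ) : ℕ := Nat.land (Nat.shiftRight M v) 0x1008040201008040201

/-- The pairs of vertices of the closed neighbourhood of `v`. -/
def sq (M v : ℕ) : ℕ := Nat.mul (col M v) (row M v)

/-- The pairs of vertices that have a common closed neighbour in `r`. -/
def unionSq (M r : ℕ) (l : List ℕ) : ℕ :=
  List.rec 0 (fun w _ U => Bool.rec (Nat.lor (sq M w) U) U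
    (Nat.beq 0 (Nat.land r (Nat.shiftLeft 1 w)))) l

/-- Can the set `r`, with transpose `c`, be enlarged by at most `d` vertices to a set of diameter
at most two? -/
def extend (M : ℕ) (l : List ℕ) (P : ℕ) (d : ℕ) : ℕ → ℕ → ℕ → Bool :=
  Nat.rec (fun r c U => Bool.rec false (sub (Nat.mul c r) U) (sub P U))
    (fun _ ih r c U => Bool.rec (anyL (fun w => force (Nat.lor U (sq M w)) fun U' =>
      ih (Nat.lor r (Nat.shiftLeft 1 w)) (Nat.lor c (Nat.shiftLeft 1 (Nat.mul 9 w))) U') l) true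
      (sub (Nat.mul c r) U)) d

def fits (d M r c P : ℕ) (l : List ℕ) : Bool :=
  force (unionSq M r l) fun U => extend M l P d r c U

def tryRest (d A B UA UB : ℕ) (l : List ℕ) (r c P : ℕ) : Bool :=
  Bool.rec (Bool.rec false (fits d B r c P l) (sub P UB)) true
    (Bool.rec false (fits d A r c P l) (sub P UA))

/-- Does the star of `v` in the graph `M` have a complement contained in a small set? -/
def tryStar (d A B full D UA UB U : ℕ) (l : List ℕ) (M v : ℕ) : Bool :=
  force (Nat.xor full (row M v)) fun r =>
  force (Nat.xor D (col M v)) fun c =>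
  force (Nat.mul c r) fun P =>
  Bool.rec false (tryRest d A B UA UB l r c P) (sub P U)

def check (d full D : ℕ) (l : List ℕ) (A B UA UB : ℕ) : Bool :=
  force (Nat.lor UA UB) fun U =>
  Bool.rec (anyL (tryStar d A B full D UA UB U l B) l) true
    (anyL (tryStar d A B full D UA UB U l A) l)

def edge (u v : ℕ) : ℕ :=
  Nat.lor (Nat.shiftLeft 1 (Nat.add (Nat.mul 9 u) v)) (Nat.shiftLeft 1 (Nat.add (Nat.mul 9 v) u))

def addEdge (u v A U : ℕ) (f : ℕ → ℕ → Bool) : Bool :=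
  force (Nat.lor A (edge u v)) fun A =>
  force (Nat.lor U (Nat.lor (sq A u) (sq A v))) fun U => f A U

/-- Try all colourings of the edges `es`. -/
def search (d full D : ℕ) (l : List ℕ) (known : ℕ → ℕ → Bool) (es : List (ℕ × ℕ)) :
    ℕ → ℕ → ℕ → ℕ → Bool :=
  List.rec (check d full D l) (fun e _ ih A B UA UB =>
    Bool.rec (Bool.rec (Bool.rec false (addEdge e.1 e.2 B UB fun B UB => ih A B UA UB)
      (addEdge e.1 e.2 A UA fun A UA => ih A B UA UB)) true (check d full D l A B UA UB)) true
      (known A B)) es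

/-- Colour the edges between `v` and `0, …, p - 1` according to the bits of `t`. -/
def setType (t v : ℕ) (k : ℕ → ℕ → ℕ → ℕ → Bool) (p : ℕ) : ℕ → ℕ → ℕ → ℕ → Bool :=
  Nat.rec k (fun i ih A B UA UB => Bool.rec (addEdge i v A UA fun A UA => ih A B UA UB)
    (addEdge i v B UB fun B UB => ih A B UA UB) (Nat.beq 0 (Nat.land t (Nat.shiftLeft 1 i)))) p

/-- Try all nondecreasing choices of types, each from its list, for the vertices in `vs`. -/
def enumerate (p : ℕ) (k : ℕ → ℕ → ℕ → ℕ → Bool) (vs : List (ℕ × List ℕ)) :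
    ℕ → ℕ → ℕ → ℕ → ℕ → Bool :=
  List.rec (fun _ => k) (fun v _ ih lo A B UA UB => allL (fun t =>
    Bool.rec true (setType t v.1 (ih t) p A B UA UB) (Nat.ble lo t)) v.2) vs

/-- For some `(v, m)` in the list, all edges between `v` and `m` have the same colour. -/
def known (vs : List (ℕ × ℕ)) (A B : ℕ) : Bool :=
  anyL (fun v => Bool.rec (sub v.2 (row B v.1)) true (sub v.2 (row A v.1))) vs

/-- Try all colourings with nondecreasing types on each of `w₁` and `w₂`. -/
def run (p : ℕ) (k : ℕ → ℕ → ℕ → ℕ → Bool) (w₁ w₂ : List (ℕ × List ℕ)) : Bool :=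
  enumerate p (enumerate p k w₂ 0) w₁ 0 0x100401004010040100401 0x100401004010040100401
    0x100401004010040100401 0x100401004010040100401

end

theorem force_eq {α : Type} (n : ℕ) (f : ℕ → α) : force n f = f n := by cases n <;> rfl

theorem rec_and (b x : Bool) : (Bool.rec false x b : Bool) = (b && x) := by cases b <;> rfl

theorem rec_or (b x : Bool) : (Bool.rec x true b : Bool) = (b || x) := by cases b <;> rfl

theorem rec_imp (b x : Bool) : (Bool.rec true x b : Bool) = (!b || x) := by cases b <;> rfl

theorem anyL_iff {α : Type} (p : α → Bool) (l : List α) :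
    anyL p l = true ↔ ∃ x ∈ l, p x = true := by
  induction l with
  | nil => simp [anyL]
  | cons h t ih =>
    have : anyL p (h :: t) = (p h || anyL p t) := rec_or _ _
    simp [this, ih]

theorem allL_iff {α : Type} (p : α → Bool) (l : List α) :
    allL p l = true ↔ ∀ x ∈ l, p x = true := by
  induction l with
  | nil => simp [allL]
  | cons h t ih =>
    have : allL p (h :: t) = (p h && allL p t) := rec_and _ _
    simp [this, ih]

theorem sub_iff {x y : ℕ} : sub x y = true ↔ ∀ i, x.testBit i = true → y.testBit i = true := by
  have : sub x y = true ↔ x &&& y = x := by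
    show Nat.beq (x &&& y) x = true ↔ _
    rw [Nat.beq_eq]
  rw [this]
  constructor
  · intro h i hi
    rw [← h, Nat.testBit_and, Bool.and_eq_true] at hi
    exact hi.2
  · intro h
    refine Nat.eq_of_testBit_eq fun i => ?_
    rw [Nat.testBit_and]
    cases hx : x.testBit i with
    | false => rfl
    | true => rw [h i hx, Bool.and_true]

theorem testBit_row (M v j : ℕ) :
    (row M v).testBit j = (M.testBit (9 * v + j) && decide (j < 9)) := by
  show ((M >>> (9 * v)) &&& (2 ^ 9 - 1)).testBit j = _
  rw [Nat.testBit_and, Nat.testBit_shiftRight, Nat.testBit_two_pow_sub_one]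

theorem testBit_col (M v x : ℕ) :
    (col M v).testBit x = (M.testBit (v + x) && diag.testBit x) := by
  show ((M >>> v) &&& diag).testBit x = _
  rw [Nat.testBit_and, Nat.testBit_shiftRight]

theorem testBit_diag {x : ℕ} : diag.testBit x = true ↔ 9 ∣ x ∧ x < 81 := by
  by_cases hx : x < 81
  · have : ∀ x < 81, diag.testBit x = true ↔ 9 ∣ x ∧ x < 81 := by decide
    exact this x hx
  · rw [Nat.testBit_lt_two_pow (lt_of_lt_of_le (by norm_num : diag < 2 ^ 81)
      (Nat.pow_le_pow_right two_pos (not_lt.1 hx)))]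
    simp [hx]

theorem row_lt (M v : ℕ) : row M v < 2 ^ 9 := by
  show (M >>> (9 * v)) &&& (2 ^ 9 - 1) < 2 ^ 9
  exact Nat.and_lt_two_pow _ (by norm_num)

/-- No carries occur: the bits of `c` are at multiples of 9 and `r` has nine bits, so the product
places a copy of `r` at each bit of `c`. It thus encodes a Cartesian product of vertex sets. The
induction peels off nine bits of `c` at a time. -/
theorem testBit_mul {r : ℕ} (hr : r < 2 ^ 9) (i : ℕ) {j : ℕ} (hj : j < 9) :
    ∀ {c : ℕ}, (∀ x, c.testBit x = true → 9 ∣ x) →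
      (c * r).testBit (9 * i + j) = (c.testBit (9 * i) && r.testBit j) := by
  induction i with
  | zero =>
    intro c hc
    have hlow : c % 2 ^ 9 = if c.testBit 0 then 1 else 0 := by
      refine Nat.eq_of_testBit_eq fun x => ?_
      rw [Nat.testBit_mod_two_pow]
      rcases Nat.eq_zero_or_pos x with rfl | hx
      · cases c.testBit 0 <;> simp
      · have h₁ : (decide (x < 9) && c.testBit x) = false := by
          by_contra h
          simp only [Bool.not_eq_false, Bool.and_eq_true, decide_eq_true_eq] at h
          have := Nat.le_of_dvd hx (hc x h.2)
          omega
        rw [h₁]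
        split_ifs
        · rw [Nat.testBit_one_eq_true_iff_self_eq_zero.not.2 hx.ne' |> Bool.eq_false_iff.2]
        · simp
    have : c * r = 2 ^ 9 * (c / 2 ^ 9 * r) + (c % 2 ^ 9) * r := by
      conv_lhs => rw [← Nat.div_add_mod c (2 ^ 9)]
      ring
    rw [this, hlow]
    have hlt : (if c.testBit 0 then 1 else 0) * r < 2 ^ 9 := by
      split_ifs <;> omega
    rw [Nat.testBit_two_pow_mul_add _ hlt, if_pos (by omega)]
    cases c.testBit 0 <;> simp
  | succ i ih =>
    intro c hc
    have hb : c % 2 ^ 9 ≤ 1 := by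
      by_contra h
      obtain ⟨x, hx, hx'⟩ := Nat.exists_testBit_of_ne_zero
        (show (c % 2 ^ 9) / 2 ≠ 0 by omega) |>.imp fun x h => And.intro (Nat.zero_le x) h
      rw [Nat.testBit_div_two, Nat.testBit_mod_two_pow, Bool.and_eq_true, decide_eq_true_eq] at hx'
      have := Nat.le_of_dvd (Nat.succ_pos x) (hc _ hx'.2)
      omega
    have : c * r = 2 ^ 9 * (c / 2 ^ 9 * r) + (c % 2 ^ 9) * r := by
      conv_lhs => rw [← Nat.div_add_mod c (2 ^ 9)]
      ring
    have hlt : c % 2 ^ 9 * r < 2 ^ 9 := lt_of_le_of_lt (Nat.mul_le_mul_right r hb) (by omega)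
    rw [this, Nat.testBit_two_pow_mul_add _ hlt, if_neg (by omega),
      show 9 * (i + 1) + j - 9 = 9 * i + j by omega, ih, Nat.testBit_div_two_pow]
    · rw [show 9 * i + 9 = 9 * (i + 1) by ring]
    · intro x hx
      rw [Nat.testBit_div_two_pow] at hx
      have := hc _ hx
      omega

theorem testBit_sq {M i j w : ℕ} (hi : i < 9) (hj : j < 9) :
    (sq M w).testBit (9 * i + j) = (M.testBit (9 * i + w) && M.testBit (9 * w + j)) := by
  show (col M w * row M w).testBit _ = _
  rw [testBit_mul (row_lt _ _) i hj, testBit_col, testBit_row, testBit_diag.2 ⟨⟨i, rfl⟩, by omega⟩,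
    add_comm w]
  · simp [hj]
  · intro x hx
    rw [testBit_col, Bool.and_eq_true] at hx
    exact (testBit_diag.1 hx.2).1

theorem beq_zero_land (r w : ℕ) : Nat.beq 0 (Nat.land r (Nat.shiftLeft 1 w)) = !r.testBit w := by
  show Nat.beq 0 (r &&& (1 <<< w)) = _
  rw [Nat.one_shiftLeft, Nat.and_two_pow]
  cases r.testBit w with
  | false => simp
  | true =>
    rw [Bool.toNat_true, one_mul, Bool.not_true, Bool.eq_false_iff]
    exact fun h => (Nat.two_pow_pos w).ne (Nat.eq_of_beq_eq_true h)

theorem testBit_unionSq {M r : ℕ} {l : List ℕ} {x : ℕ} :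
    (unionSq M r l).testBit x = true ↔ ∃ w ∈ l, r.testBit w = true ∧ (sq M w).testBit x = true := by
  induction l with
  | nil => simp [unionSq]
  | cons w l ih =>
    have : unionSq M r (w :: l) = if r.testBit w then sq M w ||| unionSq M r l
        else unionSq M r l := by
      show (Bool.rec (Nat.lor (sq M w) (unionSq M r l)) (unionSq M r l)
        (Nat.beq 0 (Nat.land r (Nat.shiftLeft 1 w))) : ℕ) = _
      rw [beq_zero_land]
      cases r.testBit w <;> rfl
    rw [this]
    cases h : r.testBit w <;> simp [ih, h, Nat.testBit_or]

end BitSearch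

/-! ### Soundness of the search -/

namespace BitSearch

/-- Every bit of `M` stands for a pair related by the symmetric relation `r`. -/
def Encodes {V : Type*} (r : V → V → Prop) (e : ℕ → V) (M : ℕ) : Prop :=
  ∀ i < 9, ∀ j < 9, M.testBit (9 * i + j) = true →
    M.testBit (9 * j + i) = true ∧ r (e i) (e j)

/-- The set `r` has diameter at most two in the graph `M`. -/
def IsClose (M r : ℕ) : Prop :=
  ∀ i < 9, ∀ j < 9, r.testBit i = true → r.testBit j = true →
    ∃ w < 9, r.testBit w = true ∧ M.testBit (9 * i + w) = true ∧ M.testBit (9 * w + j) = true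

theorem lt_of_testBit {r w : ℕ} (hr : r < 2 ^ 9) (hw : r.testBit w = true) : w < 9 := by
  by_contra h
  rw [Nat.testBit_lt_two_pow (hr.trans_le (Nat.pow_le_pow_right two_pos (not_lt.1 h)))] at hw
  exact Bool.false_ne_true hw

theorem testBit_one_shiftLeft {v i : ℕ} : (Nat.shiftLeft 1 v).testBit i = decide (v = i) := by
  show (1 <<< v).testBit i = _
  rw [Nat.one_shiftLeft, Nat.testBit_two_pow]

theorem extend_succ (M : ℕ) (l : List ℕ) (P d r c U : ℕ) :
    extend M l P (d + 1) r c U = (sub (Nat.mul c r) U || anyL (fun w => force (Nat.lor U (sq M w))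
      fun U' => extend M l P d (Nat.lor r (Nat.shiftLeft 1 w))
        (Nat.lor c (Nat.shiftLeft 1 (Nat.mul 9 w))) U') l) := rec_or _ _

theorem isClose_of_sub {M r c U : ℕ} (hr : r < 2 ^ 9) (hc : ∀ x, c.testBit x = true → 9 ∣ x)
    (hrc : ∀ i < 9, c.testBit (9 * i) = r.testBit i)
    (hU : ∀ x, U.testBit x = true → ∃ w, r.testBit w = true ∧ (sq M w).testBit x = true)
    (h : sub (Nat.mul c r) U = true) : IsClose M r := by
  intro i hi j hj hri hrj
  obtain ⟨w, hw, hs⟩ := hU _ (sub_iff.1 h (9 * i + j) (by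
    show (c * r).testBit _ = true
    rw [testBit_mul hr i hj hc, hrc i hi, hri, hrj]; rfl))
  rw [testBit_sq hi hj, Bool.and_eq_true] at hs
  exact ⟨w, lt_of_testBit hr hw, hw, hs⟩

/-- Invariant: `c` is the transpose of `r`, and every pair in `U` has a common closed neighbour in
the current `r`. The test against `P` only prunes. -/
theorem exists_isClose_of_extend {M : ℕ} {l : List ℕ} (hl : ∀ w ∈ l, w < 9) {P : ℕ} (d : ℕ) :
    ∀ {r c U : ℕ}, r < 2 ^ 9 → (∀ x, c.testBit x = true → 9 ∣ x) →
      (∀ i < 9, c.testBit (9 * i) = r.testBit i) →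
      (∀ x, U.testBit x = true → ∃ w, r.testBit w = true ∧ (sq M w).testBit x = true) →
      extend M l P d r c U = true →
      ∃ r', (∀ i, r.testBit i = true → r'.testBit i = true) ∧ IsClose M r' := by
  induction d with
  | zero =>
    intro r c U hr hc hrc hU h
    refine ⟨r, fun _ h => h, isClose_of_sub hr hc hrc hU ?_⟩
    have : (sub P U && sub (Nat.mul c r) U) = true := (rec_and _ _).symm.trans h
    exact ((Bool.and_eq_true _ _).mp this).2
  | succ d ih =>
    intro r c U hr hc hrc hU h
    rw [extend_succ, Bool.or_eq_true, anyL_iff] at h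
    rcases h with h | ⟨w, hw, h⟩
    · exact ⟨r, fun _ h => h, isClose_of_sub hr hc hrc hU h⟩
    · rw [force_eq] at h
      have hor : ∀ x y i, (Nat.lor x y).testBit i = (x.testBit i || y.testBit i) :=
        fun x y i => Nat.testBit_or x y i
      have hw9 := hl w hw
      refine (ih (r := Nat.lor r (Nat.shiftLeft 1 w))
        (c := Nat.lor c (Nat.shiftLeft 1 (Nat.mul 9 w))) ?_ ?_ ?_ ?_ h).imp fun r' hr' =>
          ⟨fun i hi => hr'.1 i (by rw [hor, hi]; rfl), hr'.2⟩
      · refine Nat.or_lt_two_pow hr ?_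
        show 1 <<< w < _
        rw [Nat.one_shiftLeft]
        exact Nat.pow_lt_pow_right (by norm_num) hw9
      · intro x hx
        rw [hor, testBit_one_shiftLeft, Bool.or_eq_true, decide_eq_true_eq] at hx
        rcases hx with hx | rfl
        · exact hc x hx
        · exact ⟨w, rfl⟩
      · intro i hi
        rw [hor, hor, hrc i hi, testBit_one_shiftLeft, testBit_one_shiftLeft]
        congr 1
        refine decide_eq_decide.2 ?_
        show 9 * w = 9 * i ↔ _
        omega
      · intro x hx
        rw [hor, Bool.or_eq_true] at hx
        rcases hx with hx | hx
        · obtain ⟨y, hy, hx⟩ := hU x hx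
          exact ⟨y, by rw [hor, hy]; rfl, hx⟩
        · exact ⟨w, by rw [hor, testBit_one_shiftLeft]; simp, hx⟩

section Sound

variable {V : Type*} {K : Bool → V → V → Prop} {e : ℕ → V}

/-- If `k` accepts two encoded graphs, there is a cover of diameter two. -/
def IsSound (K : Bool → V → V → Prop) (e : ℕ → V) (k : ℕ → ℕ → ℕ → ℕ → Bool) : Prop :=
  ∀ A B UA UB, Encodes (K true) e A → Encodes (K false) e B → k A B UA UB = true → Coverable K 2

theorem reach_of_isClose {r : V → V → Prop} {M m : ℕ} (hM : Encodes r e M) (hm : IsClose M m) :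
    ∀ u ∈ e '' {i | i < 9 ∧ m.testBit i = true}, ∀ v ∈ e '' {i | i < 9 ∧ m.testBit i = true},
      Reach r (e '' {i | i < 9 ∧ m.testBit i = true}) 2 u v := by
  rintro _ ⟨i, ⟨hi, hri⟩, rfl⟩ _ ⟨j, ⟨hj, hrj⟩, rfl⟩
  obtain ⟨w, hw, hrw, h₁, h₂⟩ := hm i hi j hj hri hrj
  exact reach_two ⟨i, ⟨hi, hri⟩, rfl⟩ ⟨w, ⟨hw, hrw⟩, rfl⟩ (hM i hi w hw h₁).2 (hM w hw j hj h₂).2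

theorem coverable_of_fits (hr : ∀ k v, K k v v) (hs : ∀ k u v, K k u v → K k v u) {k l : Bool}
    {M N v full D d P : ℕ} {L : List ℕ} (hL : ∀ w ∈ L, w < 9) (hM : Encodes (K k) e M)
    (hN : Encodes (K l) e N) (hv : v < 9) (hfull : full < 2 ^ 9)
    (hD : ∀ x, D.testBit x = true → 9 ∣ x) (hDf : ∀ i < 9, D.testBit (9 * i) = full.testBit i)
    (he : ∀ x, ∃ i < 9, full.testBit i = true ∧ e i = x)
    (h : fits d N (Nat.xor full (row M v)) (Nat.xor D (col M v)) P L = true) :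
    Coverable K 2 := by
  have hxor : ∀ x y i, (Nat.xor x y).testBit i = (x.testBit i ^^ y.testBit i) :=
    fun x y i => Nat.testBit_xor x y i
  rw [fits, force_eq] at h
  have key : ∃ r', (∀ i, (Nat.xor full (row M v)).testBit i = true → r'.testBit i = true) ∧
      IsClose N r' := by
    refine exists_isClose_of_extend hL d (Nat.xor_lt_two_pow hfull (row_lt M v)) ?_ ?_ ?_ h
    · intro x hx
      rw [hxor] at hx
      cases hDx : D.testBit x with
      | true => exact hD x hDx
      | false =>
        rw [hDx, Bool.false_xor, testBit_col, Bool.and_eq_true] at hx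
        exact (testBit_diag.1 hx.2).1
    · intro i hi
      rw [hxor, hxor, hDf i hi, testBit_col, testBit_row, testBit_diag.2 ⟨⟨i, rfl⟩, by omega⟩,
        decide_eq_true hi, Bool.and_true, Bool.and_true, add_comm v]
      congr 1
      exact Bool.eq_iff_iff.2 ⟨fun h => (hM i hi v hv h).1, fun h => (hM v hv i hi h).1⟩
    · intro x hx
      rw [testBit_unionSq] at hx
      obtain ⟨w, -, h⟩ := hx
      exact ⟨w, h⟩
  obtain ⟨r', hr', hcl⟩ := key
  refine coverable_of_two (k := k) (S := {x | K k (e v) x}) ⟨e v, hr _ _⟩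
    (reach_star (hr _) (hs _) _) (reach_of_isClose hN hcl) fun x => ?_
  obtain ⟨i, hi, hfi, rfl⟩ := he x
  cases hb : M.testBit (9 * v + i) with
  | true => exact Or.inl (hM v hv i hi hb).2
  | false =>
    refine Or.inr ⟨i, ⟨hi, hr' i ?_⟩, rfl⟩
    rw [hxor, testBit_row, hfi, hb]; rfl

theorem coverable_of_tryStar (hr : ∀ k v, K k v v) (hs : ∀ k u v, K k u v → K k v u) {k : Bool}
    {M A B v full D d UA UB U : ℕ} {L : List ℕ} (hL : ∀ w ∈ L, w < 9) (hM : Encodes (K k) e M)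
    (hA : Encodes (K true) e A) (hB : Encodes (K false) e B) (hv : v < 9) (hfull : full < 2 ^ 9)
    (hD : ∀ x, D.testBit x = true → 9 ∣ x) (hDf : ∀ i < 9, D.testBit (9 * i) = full.testBit i)
    (he : ∀ x, ∃ i < 9, full.testBit i = true ∧ e i = x)
    (h : tryStar d A B full D UA UB U L M v = true) : Coverable K 2 := by
  simp only [tryStar, force_eq, tryRest, rec_and, rec_or, Bool.and_eq_true, Bool.or_eq_true] at h
  rcases h.2 with h | h
  · exact coverable_of_fits hr hs hL hM hA hv hfull hD hDf he h.2
  · exact coverable_of_fits hr hs hL hM hB hv hfull hD hDf he h.2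

theorem isSound_check (hr : ∀ k v, K k v v) (hs : ∀ k u v, K k u v → K k v u) {full D d : ℕ}
    {L : List ℕ} (hL : ∀ w ∈ L, w < 9) (hfull : full < 2 ^ 9)
    (hD : ∀ x, D.testBit x = true → 9 ∣ x) (hDf : ∀ i < 9, D.testBit (9 * i) = full.testBit i)
    (he : ∀ x, ∃ i < 9, full.testBit i = true ∧ e i = x) :
    IsSound K e (check d full D L) := by
  intro A B UA UB hA hB h
  simp only [check, force_eq, rec_or, Bool.or_eq_true, anyL_iff] at h
  rcases h with ⟨v, hv, h⟩ | ⟨v, hv, h⟩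
  · exact coverable_of_tryStar hr hs hL hA hA hB (hL v hv) hfull hD hDf he h
  · exact coverable_of_tryStar hr hs hL hB hA hB (hL v hv) hfull hD hDf he h

theorem Encodes.edge {r : V → V → Prop} (hs : ∀ u v, r u v → r v u) {M u v : ℕ}
    (hM : Encodes r e M) (hu : u < 9) (hv : v < 9) (h : r (e u) (e v)) :
    Encodes r e (Nat.lor M (edge u v)) := by
  have hbit : ∀ x, (Nat.lor M (BitSearch.edge u v)).testBit x = true ↔
      M.testBit x = true ∨ 9 * u + v = x ∨ 9 * v + u = x := by
    intro x
    show (M ||| (Nat.shiftLeft 1 (9 * u + v) ||| Nat.shiftLeft 1 (9 * v + u))).testBit x = true ↔ _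
    simp only [Nat.testBit_or, testBit_one_shiftLeft, Bool.or_eq_true, decide_eq_true_eq]
  intro i hi j hj hij
  rw [hbit] at hij ⊢
  rcases hij with hij | hij | hij
  · exact ⟨Or.inl (hM i hi j hj hij).1, (hM i hi j hj hij).2⟩
  · obtain ⟨rfl, rfl⟩ : u = i ∧ v = j := by omega
    exact ⟨Or.inr (Or.inr rfl), h⟩
  · obtain ⟨rfl, rfl⟩ : v = i ∧ u = j := by omega
    exact ⟨Or.inr (Or.inl rfl), hs _ _ h⟩

/-- The next edge has some actual colour, and the branch for that colour still encodes only true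
relations. Accepting a partial colouring is sound because further edges never destroy a cover. -/
theorem isSound_search (hs : ∀ k u v, K k u v → K k v u) {full D d : ℕ} {L : List ℕ}
    {kn : ℕ → ℕ → Bool} (hcheck : IsSound K e (check d full D L))
    (hkn : IsSound K e fun A B _ _ => kn A B) :
    ∀ {es : List (ℕ × ℕ)}, (∀ x ∈ es, x.1 < 9 ∧ x.2 < 9 ∧ ∃ k, K k (e x.1) (e x.2)) →
      IsSound K e (search d full D L kn es)
  | [], _ => hcheck
  | x :: es, hes => by
    have ih := isSound_search hs hcheck hkn fun y hy => hes y (List.mem_cons_of_mem _ hy)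
    obtain ⟨h₁, h₂, k, hk⟩ := hes x List.mem_cons_self
    intro A B UA UB hA hB h
    have h' : (kn A B || (check d full D L A B UA UB ||
        (addEdge x.1 x.2 A UA (fun A UA => search d full D L kn es A B UA UB) &&
          addEdge x.1 x.2 B UB fun B UB => search d full D L kn es A B UA UB))) = true := by
      rw [← rec_and, ← rec_or, ← rec_or]; exact h
    simp only [addEdge, force_eq, Bool.or_eq_true, Bool.and_eq_true] at h'
    rcases h' with h | h | ⟨hA', hB'⟩
    -- `IsSound` quantifies over all `UA` and `UB`, which serve only for pruning, so any values do.
    · exact hkn A B 0 0 hA hB h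
    · exact hcheck A B UA UB hA hB h
    · cases k with
      | true => exact ih _ _ _ _ (hA.edge (hs _) h₁ h₂ hk) hB hA'
      | false => exact ih _ _ _ _ hA (hB.edge (hs _) h₁ h₂ hk) hB'

theorem isSound_setType (hs : ∀ k u v, K k u v → K k v u) {t v : ℕ} (hv : v < 9)
    {k : ℕ → ℕ → ℕ → ℕ → Bool} (hk : IsSound K e k) :
    ∀ {p : ℕ}, p ≤ 9 → (∀ i < p, K (t.testBit i) (e i) (e v)) → IsSound K e (setType t v k p)
  | 0, _, _ => hk
  | p + 1, hp, ht => by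
    have ih := isSound_setType hs hv hk (p.le_succ.trans hp) fun i hi => ht i (by omega)
    intro A B UA UB hA hB h
    have h' : (Bool.rec (addEdge p v A UA fun A UA => setType t v k p A B UA UB)
      (addEdge p v B UB fun B UB => setType t v k p A B UA UB)
        (Nat.beq 0 (Nat.land t (Nat.shiftLeft 1 p))) : Bool) = true := h
    rw [beq_zero_land] at h'
    have htp := ht p p.lt_succ_self
    cases hb : t.testBit p <;> rw [hb] at h' htp
    · simp only [Bool.not_false, addEdge, force_eq] at h'
      exact ih _ _ _ _ hA (hB.edge (hs _) (by omega) hv htp) h'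
    · simp only [Bool.not_true, addEdge, force_eq] at h'
      exact ih _ _ _ _ (hA.edge (hs _) (by omega) hv htp) hB h'

/-- The vertices in the list can be given nondecreasing types, from their lists, that describe
the colours of the edges to `0, …, p - 1`. -/
def HasTypes (K : Bool → V → V → Prop) (e : ℕ → V) (p : ℕ) : ℕ → List (ℕ × List ℕ) → Prop
  | _, [] => True
  | lo, v :: vs => v.1 < 9 ∧ ∃ t ∈ v.2, lo ≤ t ∧ (∀ i < p, K (t.testBit i) (e i) (e v.1)) ∧
      HasTypes K e p t vs

theorem isSound_enumerate (hs : ∀ k u v, K k u v → K k v u) {p : ℕ} (hp : p ≤ 9)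
    {k : ℕ → ℕ → ℕ → ℕ → Bool} (hk : IsSound K e k) :
    ∀ {vs : List (ℕ × List ℕ)} {lo : ℕ}, HasTypes K e p lo vs → IsSound K e (enumerate p k vs lo)
  | [], _, _ => hk
  | v :: vs, lo, ⟨hv, t, ht, hlo, hK, hvs⟩ => by
    intro A B UA UB hA hB h
    have h' : allL (fun t => Bool.rec true (setType t v.1 (enumerate p k vs t) p A B UA UB)
      (Nat.ble lo t)) v.2 = true := h
    have := (allL_iff _ _).1 h' t ht
    rw [rec_imp, Nat.ble_eq_true_of_le hlo, Bool.not_true, Bool.false_or] at this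
    exact isSound_setType hs hv (isSound_enumerate hs hp hk hvs) hp hK A B UA UB hA hB this

theorem encodes_refl {r : V → V → Prop} (hr : ∀ v, r v v) :
    Encodes r e 0x100401004010040100401 := by
  have : ∀ i < 9, ∀ j < 9, Nat.testBit 0x100401004010040100401 (9 * i + j) = true → i = j := by
    decide
  intro i hi j hj h
  obtain rfl := this i hi j hj h
  exact ⟨h, hr _⟩

theorem coverable_of_run (hr : ∀ k v, K k v v) (hs : ∀ k u v, K k u v → K k v u) {p : ℕ}
    (hp : p ≤ 9) {k : ℕ → ℕ → ℕ → ℕ → Bool} (hk : IsSound K e k) {w₁ w₂ : List (ℕ × List ℕ)}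
    (h₁ : HasTypes K e p 0 w₁) (h₂ : HasTypes K e p 0 w₂) (h : run p k w₁ w₂ = true) :
    Coverable K 2 :=
  isSound_enumerate hs hp (isSound_enumerate hs hp hk h₂) h₁ _ _ _ _ (encodes_refl (hr _))
    (encodes_refl (hr _)) h

theorem isSound_known {vs : List (ℕ × ℕ)} (h : ∀ v ∈ vs, v.1 < 9 ∧ ∀ k,
      (∀ j < 9, v.2.testBit j = true → K k (e v.1) (e j)) → Coverable K 2) :
    IsSound K e fun A B _ _ => known vs A B := by
  intro A B _ _ hA hB hkn
  have key : ∀ {k M v}, v ∈ vs → Encodes (K k) e M → sub v.2 (row M v.1) = true →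
      Coverable K 2 := by
    intro k M v hv hM hsub
    refine (h v hv).2 k fun j hj hvj => ?_
    have := sub_iff.1 hsub j hvj
    rw [testBit_row, Bool.and_eq_true] at this
    exact (hM _ (h v hv).1 j hj this.1).2
  simp only [known, anyL_iff, rec_or, Bool.or_eq_true] at hkn
  obtain ⟨v, hv, h | h⟩ := hkn
  · exact key hv hA h
  · exact key hv hB h

end Sound

end BitSearch

/-! ### The kernel computations -/

namespace BitSearch

/-- The edges between `3, 4, 5` and `6, 7, 8`, in an order that is good for the search. -/
def crossEdges : List (ℕ × ℕ) :=
  [(5, 8), (3, 6), (4, 7), (3, 7), (4, 8), (5, 6), (3, 8), (4, 6), (5, 7)]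

/-- The search for `K_{3,3,3}`. -/
def search₃₃₃ (kn : ℕ → ℕ → Bool) : ℕ → ℕ → ℕ → ℕ → Bool :=
  search 1 511 0x1008040201008040201 [0, 1, 2, 3, 4, 5, 6, 7, 8] kn crossEdges

/-- The search for `K_{4,2,2}`. -/
def search₄₂₂ : ℕ → ℕ → ℕ → ℕ → Bool :=
  search 2 255 0x8040201008040201 [0, 1, 2, 3, 4, 5, 6, 7] (fun _ _ => false)
    [(2, 6), (2, 7), (3, 6), (3, 7), (4, 6), (4, 7), (5, 6), (5, 7)]

/-- The pairs of a vertex of `K_{3,3,3}` and another part. -/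
def vertexParts : List (ℕ × ℕ) :=
  [(0, 56), (0, 448), (1, 56), (1, 448), (2, 56), (2, 448), (3, 7), (3, 448), (4, 7), (4, 448),
    (5, 7), (5, 448), (6, 7), (6, 56), (7, 7), (7, 56), (8, 7), (8, 56)]

theorem run_four_two_two : run 2 search₄₂₂
    [(2, [0, 1, 2, 3]), (3, [0, 1, 2, 3]), (4, [0, 1, 2, 3]), (5, [0, 1, 2, 3])]
    [(6, [0, 1, 2, 3]), (7, [0, 1, 2, 3])] = true := by decide +kernel

/-- Types 4 to 7 are those with bit 2 set, so vertex 2 is red to all of 3, 4, 5. This and the next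
three runs differ in how many of 6, 7, 8 are red to vertex 2. -/
theorem run_three_of_constant_zero : run 3 (search₃₃₃ fun _ _ => false)
    [(3, [4, 5, 6, 7]), (4, [4, 5, 6, 7]), (5, [4, 5, 6, 7])]
    [(6, [0, 1, 2, 3]), (7, [0, 1, 2, 3]), (8, [0, 1, 2, 3])] = true := by decide +kernel

theorem run_three_of_constant_one : run 3 (search₃₃₃ fun _ _ => false)
    [(3, [4, 5, 6, 7]), (4, [4, 5, 6, 7]), (5, [4, 5, 6, 7])]
    [(6, [0, 1, 2, 3]), (7, [0, 1, 2, 3]), (8, [4, 5, 6, 7])] = true := by decide +kernel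

theorem run_three_of_constant_two : run 3 (search₃₃₃ fun _ _ => false)
    [(3, [4, 5, 6, 7]), (4, [4, 5, 6, 7]), (5, [4, 5, 6, 7])]
    [(6, [0, 1, 2, 3]), (7, [4, 5, 6, 7]), (8, [4, 5, 6, 7])] = true := by decide +kernel

theorem run_three_of_constant_three : run 3 (search₃₃₃ fun _ _ => false)
    [(3, [4, 5, 6, 7]), (4, [4, 5, 6, 7]), (5, [4, 5, 6, 7])]
    [(6, [4, 5, 6, 7]), (7, [4, 5, 6, 7]), (8, [4, 5, 6, 7])] = true := by decide +kernel

/-- Types 0 and 7, a vertex with one colour to the whole first part, are excluded; `known` cuts off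
the other constant vertex-part pairs as they arise. -/
theorem run_three : run 3 (search₃₃₃ (known vertexParts))
    [(3, [1, 2, 3, 4, 5, 6]), (4, [1, 2, 3, 4, 5, 6]), (5, [1, 2, 3, 4, 5, 6])]
    [(6, [1, 2, 3, 4, 5, 6]), (7, [1, 2, 3, 4, 5, 6]), (8, [1, 2, 3, 4, 5, 6])] = true := by
  decide +kernel

end BitSearch

open BitSearch

/-! ### Diameter 2 for images of K_{4,2,2} and K_{3,3,3} -/

section Parts

variable {V : Type*} {K : Bool → V → V → Prop}

/-- Sorting the vertices of a part by type, the binary code of their colours to the first part,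
removes the symmetry within the part. -/
theorem exists_types {n p : ℕ} (c : Fin p → Fin n → Bool) :
    ∃ (σ : Equiv.Perm (Fin n)) (τ : Fin n → ℕ), Monotone τ ∧ (∀ j, τ j < 2 ^ p) ∧
      ∀ (i : Fin p) j, (τ j).testBit i = c i (σ j) := by
  let τ : Fin n → ℕ := fun j => Nat.ofBits fun i => c i j
  exact ⟨Tuple.sort τ, τ ∘ Tuple.sort τ, Tuple.monotone_sort τ, fun j => Nat.ofBits_lt_two_pow _,
    fun i j => Nat.testBit_ofBits_lt _ _ i.2⟩

/-- The enumerations `x`, `y`, `z` may repeat vertices, so smaller parts are included. -/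
theorem coverable_of_four_two_two (hr : ∀ k v, K k v v) (hs : ∀ k u v, K k u v → K k v u)
    (x : Fin 2 → V) (y : Fin 4 → V) (z : Fin 2 → V) (hxy : ∀ i j, ∃ k, K k (x i) (y j))
    (hxz : ∀ i j, ∃ k, K k (x i) (z j)) (hyz : ∀ i j, ∃ k, K k (y i) (z j))
    (hsurj : ∀ v, (∃ i, x i = v) ∨ (∃ i, y i = v) ∨ ∃ i, z i = v) : Coverable K 2 := by
  choose c hc using hxy
  choose d hd using hxz
  obtain ⟨σ, τ, hτ, hτ4, hτc⟩ := exists_types c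
  obtain ⟨σ', τ', hτ', hτ4', hτc'⟩ := exists_types d
  let e : ℕ → V := fun n => [x 0, x 1, y (σ 0), y (σ 1), y (σ 2), y (σ 3), z (σ' 0),
    z (σ' 1)].getD n (x 0)
  have mem : ∀ t < 2 ^ 2, t ∈ [0, 1, 2, 3] := by decide
  have hy : ∀ j, ∀ i < 2, K ((τ j).testBit i) (e i) (y (σ j)) := by
    intro j i hi
    rw [hτc ⟨i, hi⟩ j]
    interval_cases i <;> exact hc _ _
  have hz : ∀ j, ∀ i < 2, K ((τ' j).testBit i) (e i) (z (σ' j)) := by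
    intro j i hi
    rw [hτc' ⟨i, hi⟩ j]
    interval_cases i <;> exact hd _ _
  refine coverable_of_run (e := e) hr hs (by norm_num) (isSound_search hs
    (isSound_check hr hs (by decide) (by norm_num) ?_ (by decide) ?_)
    (fun _ _ _ _ _ _ h => absurd h Bool.false_ne_true) ?_) ?_ ?_ run_four_two_two
  · intro v hv
    by_cases h : v < 64
    · exact (by decide : ∀ v < 64, Nat.testBit 0x8040201008040201 v = true → 9 ∣ v) v h hv
    · rw [Nat.testBit_lt_two_pow (lt_of_lt_of_le (by norm_num : 0x8040201008040201 < 2 ^ 64)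
        (Nat.pow_le_pow_right two_pos (not_lt.1 h)))] at hv
      exact absurd hv Bool.false_ne_true
  · intro v
    rcases hsurj v with ⟨i, rfl⟩ | ⟨i, rfl⟩ | ⟨i, rfl⟩
    · fin_cases i
      · exact ⟨0, by norm_num, rfl, rfl⟩
      · exact ⟨1, by norm_num, rfl, rfl⟩
    · obtain ⟨i, rfl⟩ := σ.surjective i
      fin_cases i
      · exact ⟨2, by norm_num, rfl, rfl⟩
      · exact ⟨3, by norm_num, rfl, rfl⟩
      · exact ⟨4, by norm_num, rfl, rfl⟩
      · exact ⟨5, by norm_num, rfl, rfl⟩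
    · obtain ⟨i, rfl⟩ := σ'.surjective i
      fin_cases i
      · exact ⟨6, by norm_num, rfl, rfl⟩
      · exact ⟨7, by norm_num, rfl, rfl⟩
  · simp only [List.forall_mem_cons]
    exact ⟨⟨by norm_num, by norm_num, hyz _ _⟩, ⟨by norm_num, by norm_num, hyz _ _⟩,
      ⟨by norm_num, by norm_num, hyz _ _⟩, ⟨by norm_num, by norm_num, hyz _ _⟩,
      ⟨by norm_num, by norm_num, hyz _ _⟩, ⟨by norm_num, by norm_num, hyz _ _⟩,
      ⟨by norm_num, by norm_num, hyz _ _⟩, ⟨by norm_num, by norm_num, hyz _ _⟩,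
      fun _ h => absurd h List.not_mem_nil⟩
  · exact ⟨by norm_num, τ 0, mem _ (hτ4 _), Nat.zero_le _, hy 0,
      by norm_num, τ 1, mem _ (hτ4 _), hτ (by decide), hy 1,
      by norm_num, τ 2, mem _ (hτ4 _), hτ (by decide), hy 2,
      by norm_num, τ 3, mem _ (hτ4 _), hτ (by decide), hy 3, trivial⟩
  · exact ⟨by norm_num, τ' 0, mem _ (hτ4' _), Nat.zero_le _, hz 0,
      by norm_num, τ' 1, mem _ (hτ4' _), hτ' (by decide), hz 1, trivial⟩

theorem coverable_of_run_three (hr : ∀ k v, K k v v) (hs : ∀ k u v, K k u v → K k v u)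
    (x : Fin 3 → Fin 3 → V) (hx : ∀ i j, ∃ k, K k (x 1 i) (x 2 j))
    (hsurj : ∀ v, ∃ a i, x a i = v) {kn : ℕ → ℕ → Bool}
    (hkn : ∀ e : ℕ → V, (∀ a i : Fin 3, e (3 * a + i) = x a i) →
      IsSound K e fun A B _ _ => kn A B) {τ τ' : Fin 3 → ℕ}
    (hτ : Monotone τ) (hτx : ∀ (i : Fin 3) j, K ((τ j).testBit i) (x 0 i) (x 1 j))
    (hτ' : Monotone τ') (hτx' : ∀ (i : Fin 3) j, K ((τ' j).testBit i) (x 0 i) (x 2 j))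
    {l : Fin 3 → List ℕ} {l' : Fin 3 → List ℕ} (hl : ∀ j, τ j ∈ l j) (hl' : ∀ j, τ' j ∈ l' j)
    (h : run 3 (search₃₃₃ kn) [(3, l 0), (4, l 1), (5, l 2)] [(6, l' 0), (7, l' 1), (8, l' 2)]
      = true) : Coverable K 2 := by
  let e : ℕ → V := fun n => [x 0 0, x 0 1, x 0 2, x 1 0, x 1 1, x 1 2, x 2 0, x 2 1, x 2 2].getD n
    (x 0 0)
  have he : ∀ a i : Fin 3, e (3 * a + i) = x a i := by
    intro a i
    fin_cases a <;> fin_cases i <;> rfl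
  have hy : ∀ j, ∀ i < 3, K ((τ j).testBit i) (e i) (x 1 j) := by
    intro j i hi
    have := hτx ⟨i, hi⟩ j
    interval_cases i <;> exact this
  have hz : ∀ j, ∀ i < 3, K ((τ' j).testBit i) (e i) (x 2 j) := by
    intro j i hi
    have := hτx' ⟨i, hi⟩ j
    interval_cases i <;> exact this
  refine coverable_of_run (e := e) hr hs (by norm_num) (isSound_search hs
    (isSound_check hr hs (by decide) (by norm_num) (fun v hv => (testBit_diag.1 hv).1) (by decide)
      ?_) (hkn e he) ?_) ?_ ?_ h
  · intro v
    obtain ⟨a, i, rfl⟩ := hsurj v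
    refine ⟨3 * a + i, by omega, ?_, he a i⟩
    exact (by decide : ∀ i < 9, Nat.testBit 511 i = true) _ (by omega)
  · simp only [crossEdges, List.forall_mem_cons]
    exact ⟨⟨by norm_num, by norm_num, hx _ _⟩, ⟨by norm_num, by norm_num, hx _ _⟩,
      ⟨by norm_num, by norm_num, hx _ _⟩, ⟨by norm_num, by norm_num, hx _ _⟩,
      ⟨by norm_num, by norm_num, hx _ _⟩, ⟨by norm_num, by norm_num, hx _ _⟩,
      ⟨by norm_num, by norm_num, hx _ _⟩, ⟨by norm_num, by norm_num, hx _ _⟩,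
      ⟨by norm_num, by norm_num, hx _ _⟩, fun _ h => absurd h List.not_mem_nil⟩
  · exact ⟨by norm_num, τ 0, hl 0, Nat.zero_le _, hy 0,
      by norm_num, τ 1, hl 1, hτ (by decide), hy 1,
      by norm_num, τ 2, hl 2, hτ (by decide), hy 2, trivial⟩
  · exact ⟨by norm_num, τ' 0, hl' 0, Nat.zero_le _, hz 0,
      by norm_num, τ' 1, hl' 1, hτ' (by decide), hz 1,
      by norm_num, τ' 2, hl' 2, hτ' (by decide), hz 2, trivial⟩

/-- Permute the vertices inside each part. -/
theorem surjective_reindex {x : Fin 3 → Fin 3 → V} (hsurj : ∀ v, ∃ a i, x a i = v)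
    (σ : Fin 3 → Equiv.Perm (Fin 3)) (v : V) : ∃ a i, x a (σ a i) = v := by
  obtain ⟨a, i, rfl⟩ := hsurj v
  exact ⟨a, (σ a).symm i, by rw [Equiv.apply_symm_apply]⟩

theorem coverable_of_constant_aux (hr : ∀ k v, K k v v) (hs : ∀ k u v, K k u v → K k v u)
    (x : Fin 3 → Fin 3 → V) (hx : ∀ a b, a ≠ b → ∀ i j, ∃ k, K k (x a i) (x b j))
    (hsurj : ∀ v, ∃ a i, x a i = v) (h : ∀ j, K true (x 0 2) (x 1 j)) : Coverable K 2 := by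
  have hxy : ∀ i j, ∃ k, K k (x 0 i) (x 1 j) ∧ (i = 2 → k = true) := by
    intro i j
    by_cases hi : i = 2
    · exact ⟨true, hi ▸ h j, fun _ => rfl⟩
    · obtain ⟨k, hk⟩ := hx 0 1 (by decide) i j
      exact ⟨k, hk, fun h => absurd h hi⟩
  choose c hc hc2 using hxy
  choose d hd using hx 0 2 (by decide)
  obtain ⟨σ, τ, hτ, hτ8, hτc⟩ := exists_types c
  obtain ⟨σ', τ', hτ', hτ8', hτc'⟩ := exists_types d
  have hl : ∀ j, τ j ∈ [4, 5, 6, 7] := by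
    intro j
    have h₁ : (τ j).testBit 2 = true := (hτc 2 j).trans (hc2 _ _ rfl)
    exact (by decide : ∀ t < 2 ^ 3, t.testBit 2 = true → t ∈ [4, 5, 6, 7]) _ (hτ8 j) h₁
  have hlow : ∀ j, τ' j < 4 → τ' j ∈ [0, 1, 2, 3] := fun j =>
    (by decide : ∀ t < 4, t ∈ [0, 1, 2, 3]) _
  have hhigh : ∀ j, ¬ τ' j < 4 → τ' j ∈ [4, 5, 6, 7] := fun j h =>
    (by decide : ∀ t < 2 ^ 3, ¬ t < 4 → t ∈ [4, 5, 6, 7]) _ (hτ8' j) h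
  have key : ∀ l' : Fin 3 → List ℕ, (∀ j, τ' j ∈ l' j) → run 3 (search₃₃₃ fun _ _ => false)
      [(3, [4, 5, 6, 7]), (4, [4, 5, 6, 7]), (5, [4, 5, 6, 7])]
      [(6, l' 0), (7, l' 1), (8, l' 2)] = true → Coverable K 2 := fun l' hl' h =>
    coverable_of_run_three hr hs (fun a i => x a ((![1, σ, σ'] : Fin 3 → Equiv.Perm (Fin 3)) a i))
      (fun i j => hx 1 2 (by decide) _ _) (surjective_reindex hsurj _)
      (fun _ _ _ _ _ _ _ _ h => absurd h Bool.false_ne_true) hτ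
      (fun i j => by rw [hτc i j]; exact hc _ _) hτ' (fun i j => by rw [hτc' i j]; exact hd _ _)
      (l := fun _ => [4, 5, 6, 7]) hl hl' h
  -- Bit 2 is the leading bit, so in sorted order the types below 4 come first and only four
  -- patterns remain.
  have h01 : τ' 0 ≤ τ' 1 := hτ' (by decide)
  have h12 : τ' 1 ≤ τ' 2 := hτ' (by decide)
  by_cases h2 : τ' 2 < 4
  · exact key ![[0, 1, 2, 3], [0, 1, 2, 3], [0, 1, 2, 3]] (Fin.forall_fin_succ.2 ⟨hlow 0 (by omega),
      Fin.forall_fin_two.2 ⟨hlow 1 (by omega), hlow 2 (by omega)⟩⟩) run_three_of_constant_zero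
  by_cases h1 : τ' 1 < 4
  · exact key ![[0, 1, 2, 3], [0, 1, 2, 3], [4, 5, 6, 7]] (Fin.forall_fin_succ.2 ⟨hlow 0 (by omega),
      Fin.forall_fin_two.2 ⟨hlow 1 (by omega), hhigh 2 (by omega)⟩⟩) run_three_of_constant_one
  by_cases h0 : τ' 0 < 4
  · exact key ![[0, 1, 2, 3], [4, 5, 6, 7], [4, 5, 6, 7]] (Fin.forall_fin_succ.2 ⟨hlow 0 (by omega),
      Fin.forall_fin_two.2 ⟨hhigh 1 (by omega), hhigh 2 (by omega)⟩⟩) run_three_of_constant_two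
  · exact key ![[4, 5, 6, 7], [4, 5, 6, 7], [4, 5, 6, 7]] (Fin.forall_fin_succ.2 ⟨hhigh 0 (by omega),
      Fin.forall_fin_two.2 ⟨hhigh 1 (by omega), hhigh 2 (by omega)⟩⟩) run_three_of_constant_three

theorem coverable_of_constant (hr : ∀ k v, K k v v) (hs : ∀ k u v, K k u v → K k v u)
    (x : Fin 3 → Fin 3 → V) (hx : ∀ a b, a ≠ b → ∀ i j, ∃ k, K k (x a i) (x b j))
    (hsurj : ∀ v, ∃ a i, x a i = v) {a b : Fin 3} (hab : a ≠ b) {i : Fin 3} {k : Bool}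
    (h : ∀ j, K k (x a i) (x b j)) : Coverable K 2 := by
  -- Permuting parts, moving `i` to position 2 and, if needed, exchanging colours reduces to
  -- `coverable_of_constant_aux`.
  have hπ : ∀ a b : Fin 3, a ≠ b → ∃ π : Equiv.Perm (Fin 3), π 0 = a ∧ π 1 = b := by decide
  obtain ⟨π, rfl, rfl⟩ := hπ a b hab
  let x' : Fin 3 → Fin 3 → V := fun a i' => x (π a) (Equiv.swap 2 i i')
  have hx' : ∀ a b, a ≠ b → ∀ i j, ∃ k, K k (x' a i) (x' b j) := fun a b hab i j =>
    hx _ _ (π.injective.ne hab) _ _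
  have hsurj' : ∀ v, ∃ a i, x' a i = v := by
    intro v
    obtain ⟨a, i', rfl⟩ := hsurj v
    exact ⟨π.symm a, Equiv.swap 2 i i', by simp [x']⟩
  have h' : ∀ j, K k (x' 0 2) (x' 1 j) := fun j => by
    simpa [x'] using h (Equiv.swap 2 i j)
  cases k with
  | true => exact coverable_of_constant_aux hr hs x' hx' hsurj' h'
  | false =>
    refine (coverable_of_constant_aux (K := fun k => K !k) (fun _ => hr _) (fun _ => hs _) x'
      (fun a b hab i j => ?_) hsurj' h').map id Function.surjective_id not fun _ _ _ h => h
    obtain ⟨k, hk⟩ := hx' a b hab i j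
    exact ⟨!k, by rwa [Bool.not_not]⟩

theorem coverable_of_three_three_three (hr : ∀ k v, K k v v) (hs : ∀ k u v, K k u v → K k v u)
    (x : Fin 3 → Fin 3 → V) (hx : ∀ a b, a ≠ b → ∀ i j, ∃ k, K k (x a i) (x b j))
    (hsurj : ∀ v, ∃ a i, x a i = v) : Coverable K 2 := by
  by_cases hcon : ∃ a b, a ≠ b ∧ ∃ i k, ∀ j, K k (x a i) (x b j)
  · obtain ⟨a, b, hab, i, k, h⟩ := hcon
    exact coverable_of_constant hr hs x hx hsurj hab h
  push Not at hcon
  choose c hc using hx 0 1 (by decide)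
  choose d hd using hx 0 2 (by decide)
  obtain ⟨σ, τ, hτ, hτ8, hτc⟩ := exists_types c
  obtain ⟨σ', τ', hτ', hτ8', hτc'⟩ := exists_types d
  have mem : ∀ t < 2 ^ 3, (∀ k, ∃ i : Fin 3, t.testBit i ≠ k) → t ∈ [1, 2, 3, 4, 5, 6] := by
    decide
  let ρ : Fin 3 → Equiv.Perm (Fin 3) := ![1, σ, σ']
  refine coverable_of_run_three hr hs (fun a i => x a (ρ a i)) (fun i j => hx 1 2 (by decide) _ _)
    (surjective_reindex hsurj _) (fun e he => isSound_known ?_) hτ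
    (fun i j => by rw [hτc i j]; exact hc _ _) hτ' (fun i j => by rw [hτc' i j]; exact hd _ _)
    (l := fun _ => [1, 2, 3, 4, 5, 6]) (l' := fun _ => [1, 2, 3, 4, 5, 6]) (fun j => mem _ (hτ8 j) ?_)
    (fun j => mem _ (hτ8' j) ?_) run_three
  -- Each entry of `vertexParts` decodes to a vertex and a different part, so a branch cut by
  -- `known` falls under `coverable_of_constant`.
  · have hv : ∀ v ∈ vertexParts, ∃ a b : Fin 3, a ≠ b ∧ (∃ i : Fin 3, v.1 = 3 * a + i) ∧
        ∀ j : Fin 3, v.2.testBit (3 * b + j) = true := by decide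
    intro v hvm
    obtain ⟨a, b, hab, ⟨i, hi⟩, hb⟩ := hv v hvm
    refine ⟨by omega, fun k h => ?_⟩
    refine coverable_of_constant hr hs (fun a i => x a (ρ a i)) (fun a b hab _ _ => hx _ _ hab _ _)
      (surjective_reindex hsurj _) hab (i := i) (k := k) fun j => ?_
    have := h (3 * b + j) (by omega) (hb j)
    rwa [hi, he, he] at this
  · intro k
    by_contra! h
    obtain ⟨i, hi⟩ := hcon 1 0 (by decide) (σ j) k
    exact hi (hs _ _ _ (by rw [← h i, hτc]; exact hc _ _))
  · intro k
    by_contra! h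
    obtain ⟨i, hi⟩ := hcon 2 0 (by decide) (σ' j) k
    exact hi (hs _ _ _ (by rw [← h i, hτc']; exact hd _ _))

end Parts

/-! ### Colourings without good covers -/

namespace BitSearch

noncomputable section

/-- The set `m` has diameter at most two in the graph `M`. -/
def isClose (M m : ℕ) : Bool :=
  force (unionSq M m [0, 1, 2, 3, 4, 5, 6, 7, 8]) fun U =>
    allL (fun i => Bool.rec (sub m (row U i)) true (Nat.beq 0 (Nat.land m (Nat.shiftLeft 1 i))))
      [0, 1, 2, 3, 4, 5, 6, 7, 8]

/-- No two sets, of diameter at most two in `A` and in `B`, cover all vertices. -/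
def noCover (A B : ℕ) : Bool :=
  allL (fun m => Bool.rec true (allL (fun n => Bool.rec true (Bool.rec true false (isClose B n))
    (Nat.beq (Nat.lor m n) 511)) (List.range 512)) (isClose A m)) (List.range 512)

end

theorem isClose_ofBits {M : ℕ} {f : Fin 9 → Bool} (h : ∀ i j, f i = true → f j = true →
      ∃ w, f w = true ∧ M.testBit (9 * i + w) = true ∧ M.testBit (9 * w + j) = true) :
    isClose M (Nat.ofBits f) = true := by
  have hf : ∀ j, (Nat.ofBits f).testBit j = true → ∃ h : j < 9, f ⟨j, h⟩ = true := by
    intro j hj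
    have h9 := lt_of_testBit (Nat.ofBits_lt_two_pow f) hj
    exact ⟨h9, by rwa [Nat.testBit_ofBits_lt _ _ h9] at hj⟩
  simp only [isClose, force_eq, allL_iff, beq_zero_land]
  intro i hi
  cases hb : (Nat.ofBits f).testBit i with
  | false => rfl
  | true =>
    refine sub_iff.2 fun j hj => ?_
    obtain ⟨hi9, hfi⟩ := hf i hb
    obtain ⟨hj9, hfj⟩ := hf j hj
    obtain ⟨w, hw, h₁, h₂⟩ := h _ _ hfi hfj
    rw [testBit_row, Bool.and_eq_true, testBit_unionSq]
    refine ⟨⟨w, (by decide : ∀ w : Fin 9, (w : ℕ) ∈ [0, 1, 2, 3, 4, 5, 6, 7, 8]) w, ?_, ?_⟩,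
      decide_eq_true hj9⟩
    · rwa [Nat.testBit_ofBits_lt _ _ w.2]
    · rw [testBit_sq hi9 hj9, Bool.and_eq_true]
      exact ⟨h₁, h₂⟩

theorem noCover_spec {A B m n : ℕ} (h : noCover A B = true) (hm : m < 512) (hn : n < 512)
    (hA : isClose A m = true) (hB : isClose B n = true) (hmn : m ||| n = 511) : False := by
  have h₁ := (allL_iff _ _).1 h m (List.mem_range.2 hm)
  rw [hA] at h₁
  have h₂ := (allL_iff _ _).1 h₁ n (List.mem_range.2 hn)
  have : Nat.beq (Nat.lor m n) 511 = true := by rw [Nat.beq_eq]; exact hmn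
  rw [this, hB] at h₂
  exact Bool.false_ne_true h₂

theorem not_coverable_of_noCover {K : Bool → Fin 9 → Fin 9 → Prop} {M : Bool → ℕ}
    (hM : ∀ k (i j : Fin 9), K k i j → (M k).testBit (9 * i + j) = true)
    (h : ∀ k l, noCover (M k) (M l) = true) : ¬ Coverable K 2 := by
  classical
  rintro ⟨S, k, hS, hc⟩
  let f : Fin 2 → Fin 9 → Bool := fun a i => decide (i ∈ S a)
  have hf : ∀ a i, f a i = true ↔ i ∈ S a := fun a i => decide_eq_true_iff
  have hclose : ∀ a, isClose (M (k a)) (Nat.ofBits (f a)) = true := by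
    intro a
    refine isClose_ofBits fun i j hi hj => ?_
    obtain ⟨w, hw, ⟨_, -, rfl, h₁⟩, h₂⟩ := (hS a).2 i ((hf a i).1 hi) j ((hf a j).1 hj)
    exact ⟨w, (hf a w).2 hw, hM _ _ _ h₁, hM _ _ _ h₂⟩
  refine noCover_spec (h (k 0) (k 1)) (Nat.ofBits_lt_two_pow _) (Nat.ofBits_lt_two_pow _)
    (hclose 0) (hclose 1) (Nat.eq_of_testBit_eq fun i => ?_)
  rw [Nat.testBit_or, show 511 = 2 ^ 9 - 1 from rfl, Nat.testBit_two_pow_sub_one]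
  by_cases hi : i < 9
  · rw [Nat.testBit_ofBits_lt _ _ hi, Nat.testBit_ofBits_lt _ _ hi, decide_eq_true hi,
      Bool.or_eq_true, hf, hf]
    exact Fin.exists_fin_two.1 (hc ⟨i, hi⟩)
  · rw [Nat.testBit_ofBits_ge _ _ (not_lt.1 hi), Nat.testBit_ofBits_ge _ _ (not_lt.1 hi),
      decide_eq_false hi]
    rfl

theorem not_alwaysCoverable_of_noCover {p : Fin 9 → Fin 3} (M : Bool → ℕ)
    (hs : ∀ i j : Fin 9, (M true).testBit (9 * i + j) = (M true).testBit (9 * j + i))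
    (hM : ∀ k (i j : Fin 9), (i = j ∨ p i ≠ p j ∧ (M true).testBit (9 * i + j) = k) →
      (M k).testBit (9 * i + j) = true)
    (h : ∀ k l, noCover (M k) (M l) = true) : ¬ AlwaysCoverable p 2 := fun hp =>
  not_coverable_of_noCover (K := partRel p fun i j => (M true).testBit (9 * i + j)) hM h (hp _ hs)

end BitSearch

/-- Red is K_{4,4} minus the perfect matching `i`, `i + 5` between 0–3 and 5–8, that is, a cube;
vertex 4 is red-isolated. Two of 0–3 are never within blue distance 2, so two blue sets fail, and
two red sets fail because the cube has diameter 3. With one of each, red omits a vertex of every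
antipodal pair `i`, `i + 5`. Blue has at most one vertex `i` of 0–3, so it must contain the partners
of the other three, one of which is at blue distance 3 from `i`; without such an `i`, the red set
would be 0–3, which has no red edges. The kernel verifies this by running over all pairs of subsets.
-/
theorem not_alwaysCoverable_five_two_two :
    ¬ AlwaysCoverable (![0, 0, 0, 0, 0, 1, 1, 2, 2] : Fin 9 → Fin 3) 2 :=
  BitSearch.not_alwaysCoverable_of_noCover (fun k => bif k then 0x107459345c107459345c1 else 0x1787a74b63f0842108421)
    (by decide) (by decide +kernel) (by decide +kernel)

/-- The two numbers are the closed adjacency matrices of red and blue; the exhaustive check over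
pairs of subsets is the whole argument. -/
theorem not_alwaysCoverable_four_three_two :
    ¬ AlwaysCoverable (![0, 0, 0, 0, 1, 1, 1, 2, 2] : Fin 9 → Fin 3) 2 :=
  BitSearch.not_alwaysCoverable_of_noCover (fun k => bif k then 0x1075c90d469544452c5f1 else 0x17863732591abc3912401)
    (by decide) (by decide +kernel) (by decide +kernel)

/-! ### Subgraphs, permuted parts and the extremal graphs -/

section Complete

variable {V W : Type*} {p : V → Fin 3} {q : W → Fin 3}

/-- Retract `V` onto the copy of `W`: a vertex outside the image goes to a chosen representative of
the corresponding part. This respects parts, so `AlwaysCoverable.map` applies. -/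
theorem AlwaysCoverable.of_injective {d : ℕ} (h : AlwaysCoverable p d) (hq : q.Surjective)
    {f : W → V} (hf : f.Injective) (hfp : ∀ u v, q u ≠ q v → p (f u) ≠ p (f v)) :
    AlwaysCoverable q d := by
  classical
  choose s hs using hq
  -- Representatives of the three parts of `W` land in three distinct parts of `V`, which matches
  -- the parts by a permutation `π`.
  have hinj : (fun i => p (f (s i))).Injective := fun i j hij => by
    by_contra hne
    exact hfp (s i) (s j) (by rwa [hs, hs]) hij
  let π : Equiv.Perm (Fin 3) := Equiv.ofBijective _ (Finite.injective_iff_bijective.1 hinj)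
  have hπ : ∀ u, π (q u) = p (f u) := by
    intro u
    obtain ⟨j, hj⟩ := π.surjective (p (f u))
    rw [← hj]
    by_contra hne
    exact hfp u (s j) (by rw [hs]; exact fun h => hne (by rw [h])) hj.symm
  refine h.map (fun v => if hv : ∃ u, f u = v then hv.choose else s (π.symm (p v))) (fun u => ?_) ?_
  · have hu : ∃ u', f u' = f u := ⟨u, rfl⟩
    exact ⟨f u, (dif_pos hu).trans (hf hu.choose_spec)⟩
  · have key : ∀ v, π (q (if hv : ∃ u, f u = v then hv.choose else s (π.symm (p v)))) = p v := by
      intro v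
      split_ifs with hv
      · rw [hπ, hv.choose_spec]
      · rw [hs, Equiv.apply_symm_apply]
    intro u v huv h
    rw [← key u, ← key v, h] at huv
    exact huv rfl

theorem exists_surjective_fin {m k : ℕ} (hm : 1 ≤ m) (hk : m ≤ k) :
    ∃ f : Fin k → Fin m, f.Surjective :=
  ⟨fun i => ⟨min i (m - 1), by omega⟩, fun j => ⟨⟨j, by omega⟩, Fin.ext (by simp; omega)⟩⟩

theorem alwaysCoverable_two_of_le_three {n : Fin 3 → ℕ} (h₁ : ∀ i, 1 ≤ n i) (h₃ : ∀ i, n i ≤ 3) :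
    AlwaysCoverable (Sigma.fst : (Σ i, Fin (n i)) → Fin 3) 2 := by
  intro c hc
  choose f hf using fun i => exists_surjective_fin (h₁ i) (h₃ i)
  refine coverable_of_three_three_three (partRel_refl _ c) (partRel_symm hc)
    (fun a i => ⟨a, f a i⟩) (fun a b hab i j => ⟨_, Or.inr ⟨hab, rfl⟩⟩) ?_
  rintro ⟨a, v⟩
  obtain ⟨i, rfl⟩ := hf a v
  exact ⟨a, i, rfl⟩

theorem alwaysCoverable_two_of_le_four_two_two {n : Fin 3 → ℕ} (h₁ : ∀ i, 1 ≤ n i) (h0 : n 0 ≤ 4)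
    (h1 : n 1 ≤ 2) (h2 : n 2 ≤ 2) :
    AlwaysCoverable (Sigma.fst : (Σ i, Fin (n i)) → Fin 3) 2 := by
  intro c hc
  obtain ⟨f, hf⟩ := exists_surjective_fin (h₁ 0) h0
  obtain ⟨g, hg⟩ := exists_surjective_fin (h₁ 1) h1
  obtain ⟨k, hk⟩ := exists_surjective_fin (h₁ 2) h2
  refine coverable_of_four_two_two (partRel_refl _ c) (partRel_symm hc) (fun i => ⟨1, g i⟩)
    (fun i => ⟨0, f i⟩) (fun i => ⟨2, k i⟩)
    (fun i j => ⟨_, Or.inr ⟨(by decide : (1 : Fin 3) ≠ 0), rfl⟩⟩)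
    (fun i j => ⟨_, Or.inr ⟨(by decide : (1 : Fin 3) ≠ 2), rfl⟩⟩)
    (fun i j => ⟨_, Or.inr ⟨(by decide : (0 : Fin 3) ≠ 2), rfl⟩⟩) ?_
  rintro ⟨a, v⟩
  fin_cases a
  · obtain ⟨i, rfl⟩ := hf v
    exact Or.inr (Or.inl ⟨i, rfl⟩)
  · obtain ⟨i, rfl⟩ := hg v
    exact Or.inl ⟨i, rfl⟩
  · obtain ⟨i, rfl⟩ := hk v
    exact Or.inr (Or.inr ⟨i, rfl⟩)

open SimpleGraph

theorem alwaysCoverable_of_iso {G : SimpleGraph V} {H : SimpleGraph W}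
    (hG : ∀ u v, G.Adj u v ↔ p u ≠ p v) (hH : ∀ u v, H.Adj u v ↔ q u ≠ q v) (φ : G ≃g H) {d : ℕ}
    (h : AlwaysCoverable q d) : AlwaysCoverable p d :=
  h.map φ.symm φ.symm.surjective fun _ _ huv =>
    (hG _ _).1 (φ.symm.map_adj_iff.2 ((hH _ _).2 huv))

/-- Permuting the parts. -/
theorem nonempty_iso_of_perm {m n : Fin 3 → ℕ} (σ : Equiv.Perm (Fin 3)) (h : ∀ i, m i = n (σ i)) :
    Nonempty (completeMultipartiteGraph (fun i => Fin (n i)) ≃g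
      completeMultipartiteGraph fun i => Fin (m i)) := by
  obtain rfl : m = fun i => n (σ i) := funext h
  refine ⟨RelIso.symm ⟨Equiv.sigmaCongrLeft (β := fun i => Fin (n i)) σ, ?_⟩⟩
  rintro ⟨i, _⟩ ⟨j, _⟩
  exact not_congr σ.injective.eq_iff

theorem IsCompleteTripartite.exists_sorted {G : SimpleGraph V} (hG : IsCompleteTripartite G) :
    ∃ a b c : ℕ, b ≤ a ∧ c ≤ b ∧ 1 ≤ c ∧ Nonempty (G ≃g completeTripartiteGraph a b c) := by
  obtain ⟨a, b, c, ha, hb, hc, ⟨φ⟩⟩ := hG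
  let n : Fin 3 → ℕ := ![a, b, c]
  have hn : ∀ i, 1 ≤ n i := Fin.forall_fin_succ.2 ⟨ha, Fin.forall_fin_two.2 ⟨hb, hc⟩⟩
  let σ := Tuple.sort (OrderDual.toDual ∘ n)
  have hσ : Antitone (n ∘ σ) := Tuple.monotone_sort (OrderDual.toDual ∘ n)
  obtain ⟨ψ⟩ := nonempty_iso_of_perm (m := ![n (σ 0), n (σ 1), n (σ 2)]) (n := n) σ
    (Fin.forall_fin_succ.2 ⟨rfl, Fin.forall_fin_two.2 ⟨rfl, rfl⟩⟩)
  exact ⟨n (σ 0), n (σ 1), n (σ 2), hσ (by decide), hσ (by decide), hn _, ⟨φ.trans ψ⟩⟩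

theorem completeTripartiteGraph_isContained {a b c a' b' c' : ℕ} (ha : a ≤ a') (hb : b ≤ b')
    (hc : c ≤ c') : (completeTripartiteGraph a b c).IsContained (completeTripartiteGraph a' b' c') := by
  have h : ∀ i, ![a, b, c] i ≤ ![a', b', c'] i :=
    Fin.forall_fin_succ.2 ⟨ha, Fin.forall_fin_two.2 ⟨hb, hc⟩⟩
  let f : (Σ i, Fin (![a, b, c] i)) → Σ i, Fin (![a', b', c'] i) :=
    Sigma.map id fun i => Fin.castLE (h i)
  have hf : f.Injective := Function.injective_id.sigma_map fun i => Fin.castLE_injective (h i)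
  exact ⟨⟨⟨f, fun h => h⟩, hf⟩⟩

variable {G : SimpleGraph V}

theorem not_alwaysCoverable_two_of_isContained (hG : ∀ u v, G.Adj u v ↔ p u ≠ p v)
    (h : (completeTripartiteGraph 5 2 2).IsContained G ∨
      (completeTripartiteGraph 4 3 2).IsContained G) : ¬ AlwaysCoverable p 2 := by
  intro hp
  rcases h with ⟨⟨φ⟩⟩ | ⟨⟨φ⟩⟩
  · let e : Fin 9 → Σ i : Fin 3, Fin (![5, 2, 2] i) :=
      ![⟨0, (0 : Fin 5)⟩, ⟨0, (1 : Fin 5)⟩, ⟨0, (2 : Fin 5)⟩, ⟨0, (3 : Fin 5)⟩, ⟨0, (4 : Fin 5)⟩, ⟨1, (0 : Fin 2)⟩, ⟨1, (1 : Fin 2)⟩, ⟨2, (0 : Fin 2)⟩, ⟨2, (1 : Fin 2)⟩]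
    refine not_alwaysCoverable_five_two_two (hp.of_injective (f := fun i => φ (e i)) (by decide)
      (φ.injective.comp (by decide : e.Injective)) fun u v huv => ?_)
    exact (hG _ _).1 (φ.toHom.map_adj ((by decide : ∀ u v : Fin 9,
      (![0, 0, 0, 0, 0, 1, 1, 2, 2] : Fin 9 → Fin 3) u ≠ (![0, 0, 0, 0, 0, 1, 1, 2, 2] :
        Fin 9 → Fin 3) v → (e u).1 ≠ (e v).1) u v huv))
  · let e : Fin 9 → Σ i : Fin 3, Fin (![4, 3, 2] i) :=
      ![⟨0, (0 : Fin 4)⟩, ⟨0, (1 : Fin 4)⟩, ⟨0, (2 : Fin 4)⟩, ⟨0, (3 : Fin 4)⟩, ⟨1, (0 : Fin 3)⟩, ⟨1, (1 : Fin 3)⟩, ⟨1, (2 : Fin 3)⟩, ⟨2, (0 : Fin 2)⟩, ⟨2, (1 : Fin 2)⟩]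
    refine not_alwaysCoverable_four_three_two (hp.of_injective (f := fun i => φ (e i)) (by decide)
      (φ.injective.comp (by decide : e.Injective)) fun u v huv => ?_)
    exact (hG _ _).1 (φ.toHom.map_adj ((by decide : ∀ u v : Fin 9,
      (![0, 0, 0, 0, 1, 1, 1, 2, 2] : Fin 9 → Fin 3) u ≠ (![0, 0, 0, 0, 1, 1, 1, 2, 2] :
        Fin 9 → Fin 3) v → (e u).1 ≠ (e v).1) u v huv))

theorem alwaysCoverable_one_of_iso (hG : ∀ u v, G.Adj u v ↔ p u ≠ p v)
    (h : Nonempty (G ≃g completeTripartiteGraph 1 1 1) ∨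
      Nonempty (G ≃g completeTripartiteGraph 2 1 1)) : AlwaysCoverable p 1 := by
  rcases h with ⟨⟨φ⟩⟩ | ⟨⟨φ⟩⟩
  · exact alwaysCoverable_of_iso hG (fun _ _ => Iff.rfl) φ (alwaysCoverable_one_of_pairs
      (p := (Sigma.fst : (Σ i : Fin 3, Fin (![1, 1, 1] i)) → Fin 3))
      (x := ⟨0, (0 : Fin 1)⟩) (y := ⟨1, (0 : Fin 1)⟩) (x' := ⟨0, (0 : Fin 1)⟩) (y' := ⟨2, (0 : Fin 1)⟩) (by decide) (by decide) (by decide))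
  · exact alwaysCoverable_of_iso hG (fun _ _ => Iff.rfl) φ (alwaysCoverable_one_of_pairs
      (p := (Sigma.fst : (Σ i : Fin 3, Fin (![2, 1, 1] i)) → Fin 3))
      (x := ⟨0, (0 : Fin 2)⟩) (y := ⟨1, (0 : Fin 1)⟩) (x' := ⟨0, (1 : Fin 2)⟩) (y' := ⟨2, (0 : Fin 1)⟩) (by decide) (by decide) (by decide))

end Complete

/-! ### The classification -/

theorem mainTheorem1 {V : Type*} (G : SimpleGraph V) (hG : IsCompleteTripartite G) :
    (diameterCoverNumber 2 2 G = 3 ↔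
      (completeTripartiteGraph 5 2 2).IsContained G ∨
        (completeTripartiteGraph 4 3 2).IsContained G) ∧
    (diameterCoverNumber 2 2 G = 1 ↔
      Nonempty (G ≃g completeTripartiteGraph 1 1 1) ∨
        Nonempty (G ≃g completeTripartiteGraph 2 1 1)) ∧
    (¬ ((completeTripartiteGraph 5 2 2).IsContained G ∨
          (completeTripartiteGraph 4 3 2).IsContained G) →
      ¬ (Nonempty (G ≃g completeTripartiteGraph 1 1 1) ∨
          Nonempty (G ≃g completeTripartiteGraph 2 1 1)) →
      diameterCoverNumber 2 2 G = 2) := by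
  obtain ⟨a, b, c, hba, hcb, hc, ⟨φ⟩⟩ := hG.exists_sorted
  let n : Fin 3 → ℕ := ![a, b, c]
  have hn : ∀ i, 1 ≤ n i :=
    Fin.forall_fin_succ.2 ⟨by show 1 ≤ a; omega, Fin.forall_fin_two.2 ⟨by show 1 ≤ b; omega, hc⟩⟩
  let p : V → Fin 3 := fun v => (φ v).1
  have hp : ∀ u v, G.Adj u v ↔ p u ≠ p v := fun u v => φ.map_adj_iff.symm
  have transfer : ∀ {d}, AlwaysCoverable (Sigma.fst : (Σ i, Fin (n i)) → Fin 3) d →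
      AlwaysCoverable p d := alwaysCoverable_of_iso hp (fun _ _ => Iff.rfl) φ
  have hinj : ∀ {i j : Fin 3}, i ≠ j → φ.symm ⟨i, ⟨0, hn i⟩⟩ ≠ φ.symm ⟨j, ⟨0, hn j⟩⟩ :=
    fun hij h => hij (congrArg Sigma.fst (φ.symm.injective h))
  have h3 : AlwaysCoverable p 3 :=
    transfer (alwaysCoverable_three fun i => ⟨⟨i, ⟨0, hn i⟩⟩, rfl⟩)
  have h0 : ¬ AlwaysCoverable p 0 := not_alwaysCoverable_zero (hinj (by decide : (0 : Fin 3) ≠ 1))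
    (hinj (by decide : (0 : Fin 3) ≠ 2)) (hinj (by decide : (1 : Fin 3) ≠ 2))
  have h2 : AlwaysCoverable p 2 ↔ ¬ ((completeTripartiteGraph 5 2 2).IsContained G ∨
      (completeTripartiteGraph 4 3 2).IsContained G) := by
    refine ⟨fun h h' => not_alwaysCoverable_two_of_isContained hp h' h, fun h => ?_⟩
    have h5 : ¬ (5 ≤ a ∧ 2 ≤ b ∧ 2 ≤ c) := fun ⟨ha, hb, hc⟩ => h (Or.inl
      ((completeTripartiteGraph_isContained ha hb hc).trans ⟨φ.symm.toCopy⟩))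
    have h4 : ¬ (4 ≤ a ∧ 3 ≤ b ∧ 2 ≤ c) := fun ⟨ha, hb, hc⟩ => h (Or.inr
      ((completeTripartiteGraph_isContained ha hb hc).trans ⟨φ.symm.toCopy⟩))
    apply transfer
    -- With `a ≥ b ≥ c ≥ 2`, excluding K_{5,2,2} gives `a ≤ 4`, and excluding K_{4,3,2} forces `b =
    -- c = 2` when `a = 4`.
    by_cases hc1 : c = 1
    · subst hc1
      refine alwaysCoverable_two_of_singleton (z := ⟨2, ⟨0, hn 2⟩⟩) ?_
      rintro ⟨i, v⟩ rfl
      exact congrArg _ (Subsingleton.elim (α := Fin 1) v _)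
    by_cases ha : a ≤ 3
    · exact alwaysCoverable_two_of_le_three hn
        (Fin.forall_fin_succ.2 ⟨ha, Fin.forall_fin_two.2 ⟨hba.trans ha, hcb.trans (hba.trans ha)⟩⟩)
    · exact alwaysCoverable_two_of_le_four_two_two hn (by show a ≤ 4; omega) (by show b ≤ 2; omega)
        (by show c ≤ 2; omega)
  have h1 : AlwaysCoverable p 1 ↔ Nonempty (G ≃g completeTripartiteGraph 1 1 1) ∨
      Nonempty (G ≃g completeTripartiteGraph 2 1 1) := by
    refine ⟨fun h => ?_, alwaysCoverable_one_of_iso hp⟩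
    let _ : Fintype V := Fintype.ofEquiv _ φ.toEquiv.symm
    have hcard := card_le_four_of_alwaysCoverable_one h
    rw [Fintype.card_congr φ.toEquiv, Fintype.card_sigma, Fin.sum_univ_three] at hcard
    simp only [Fintype.card_fin] at hcard
    change a + b + c ≤ 4 at hcard
    obtain ⟨rfl, rfl, rfl⟩ | ⟨rfl, rfl, rfl⟩ : (a = 1 ∧ b = 1 ∧ c = 1) ∨ (a = 2 ∧ b = 1 ∧ c = 1) := by
      omega
    · exact Or.inl ⟨φ⟩
    · exact Or.inr ⟨φ⟩
  have hD := diameterCoverNumber_le_iff hp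
  -- The number is finite, so it is a natural number `m` with `1 ≤ m ≤ 3`; `h1` and `h2` decide its
  -- value by arithmetic.
  obtain ⟨m, hm⟩ := ENat.ne_top_iff_exists.1
    (ne_top_of_le_ne_top (ENat.natCast_ne_top 3) ((hD 3).2 h3))
  simp only [← hm, Nat.cast_le] at hD ⊢
  rw [← hD] at h0 h1 h2 h3
  norm_cast
  refine ⟨?_, ?_, fun hX hY => ?_⟩
  · rw [← not_iff_not, ← h2]; omega
  · rw [← h1]; omega
  · rw [← h2] at hX; rw [← h1] at hY; omega
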